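/- Let $\mathbb T^3=(\mathbb R/\mathbb Z)^3$ with its normalized Haar measure, and let $e_\Delta(k)=\sum_{i=1}^3\bigl(1-\cos(2\pi k_i)\bigr)$ for $k\in\mathbb T^3$. Let $I\subset\mathbb C$ be the contour $$I=[-1,7]\cup\bigl([-1,7]-i\bigr)\cup\bigl(-1-i(0,1]\bigr)\cup\bigl(7-i(0,1]\bigr),$$ and let $\bar I$ be its complex conjugate. For $\varepsilon>0$, $w\in\mathbb T^3$, $\alpha\in I$, $\beta\in\bar I$, a choice of $\alpha_1,\alpha_2,\alpha_3\in\{\alpha,\beta\}$ and an arbitrary, mutually independent choice of the four signs $\pm$, put $$A_\varepsilon(w;\alpha,\beta)=\int_{(\mathbb T^3)^2}\frac{dp\,dq}{|e_\Delta(p)-\alpha_1\pm i\varepsilon|\;|e_\Delta(q)-\alpha_2\pm i\varepsilon|\;|e_\Delta(p\pm q+w)-\alpha_3\pm i\varepsilon|}\in[0,\infty].$$ Then there is a constant $C<\infty$ such that for all $0<\varepsilon\le\frac12$, all choices of the signs, and all choices of which of $\alpha,\beta$ each $\alpha_j$ is, $$\sup_{w\in\mathbb T^3}\;\sup_{\alpha\in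 I}\;\sup_{\beta\in\bar I}\;A_\varepsilon(w;\alpha,\beta)<C\,\varepsilon^{-4/5}\Bigl(\log\frac1\varepsilon\Bigr)^2 .$$ -/

import Mathlib

namespace LatticeCrossing

open MeasureTheory
open scoped ENNReal

/-- The torus `𝕋³ = (ℝ/ℤ)³`. Its `volume` is the product of the Haar probability measures. -/
abbrev Torus3 : Type := Fin 3 → UnitAddCircle

theorem cos_two_pi_periodic :
    Function.Periodic (fun x : ℝ => Real.cos (2 * Real.pi * x)) 1 := by
  intro x
  simp only [mul_add, mul_one, Real.cos_add_two_pi]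

/-- The function `k ↦ cos (2 π k)` on the circle `ℝ/ℤ`. -/
noncomputable def cosTwoPi : UnitAddCircle → ℝ :=
  cos_two_pi_periodic.lift

/-- The lattice kinetic energy `e_Δ(k) = ∑ᵢ (1 - cos (2 π kᵢ))`. -/
noncomputable def kineticEnergy (k : Torus3) : ℝ :=
  ∑ i, (1 - cosTwoPi (k i))

/-- The contour `I = [-1,7] ∪ ([-1,7] - i) ∪ (-1 - i(0,1]) ∪ (7 - i(0,1])`, as a set. -/
def contour : Set ℂ :=
  Complex.reProdIm (Set.Icc (-1) 7) {0} ∪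
    (Complex.reProdIm (Set.Icc (-1) 7) {-1} ∪
      Complex.reProdIm {-1} (Set.Ico (-1) 0) ∪
      Complex.reProdIm {7} (Set.Ico (-1) 0))

/-- The complex conjugate of the contour. -/
def conjContour : Set ℂ := (starRingEnd ℂ) '' contour

/-- The modulus of the resolvent `1 / |e_Δ(k) - z + s i ε|` with sign `s = ±1`, as an element of
`[0,∞]` (it is `∞` where the denominator vanishes). -/
noncomputable def resolventModulus (ε : ℝ) (s : ℤˣ) (z : ℂ) (k : Torus3) : ℝ≥0∞ :=
  ‖(kineticEnergy k : ℂ) - z + ((s : ℤ) : ℂ) * Complex.I * (ε : ℂ)‖ₑ⁻¹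

/-- The crossing integral `A_ε(w; α, β)`. The signs in front of `iε` in the three resolvents are
`s 0, s 1, s 2`, the sign in `p ± q + w` is `κ`, and `ν` tells which of `α, β` is the spectral
parameter of each of the three resolvents. -/
noncomputable def crossingIntegral (s : Fin 3 → ℤˣ) (κ : ℤˣ) (ν : Fin 3 → Fin 2)
    (ε : ℝ) (w : Torus3) (α β : ℂ) : ℝ≥0∞ :=
  ∫⁻ x : Torus3 × Torus3,
    resolventModulus ε (s 0) (![α, β] (ν 0)) x.1 *
    resolventModulus ε (s 1) (![α, β] (ν 1)) x.2 *
    resolventModulus ε (s 2) (![α, β] (ν 2)) (x.1 + (κ : ℤ) • x.2 + w)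

end LatticeCrossing

namespace LatticeCrossing

open MeasureTheory UnitAddTorus
open scoped ENNReal ComplexConjugate

/-! Each resolvent modulus is dominated by a logarithmic number J of Lorentzians in `kineticEnergy`,
at the dyadic scales between ε and a constant (`inv_sqrt_le_dyadicMajorant`, `resolventModulus_le`).
The crossing integral thus becomes a double convolution of three continuous functions, and Parseval
bounds it by the sum over n ∈ ℤ³ of products of moduli of Fourier coefficients; w enters only
through a phase (`abs_integral_triple_le_tsum`).

The decisive input is that the coefficients of a Lorentzian are O((1 + |n_j|)^(-1/2)) for every
coordinate j, uniformly in width and level. By the Laplace transform they are time integrals of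
products of three Bessel factors. Stationary phase, uniform up to the turning point t = |m|, bounds
each factor by (|t - |m|| t)^(-1/4); its cube is integrable across the turning point and decays like
t^(-3/2). For t well below |n_j| the j-th factor is itself very small.

Frequencies in a box of side about N contribute J³ N^(3/2) by this decay. Outside it one factor is
at most of order J N^(-1/2), and the other two are square summable with sum O(J/ε). Taking N about
ε^(-1/2) gives J³ ε^(-3/4), and the gap between 3/4 and 4/5 absorbs J³. -/

/-! ### Oscillatory integrals near a turning point -/

theorem integral_deriv_div_sq_add_sq_le {f f' : ℝ → ℝ} (hf : ∀ x, HasDerivAt f (f' x) x)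
    (hc : Continuous f') {μ : ℝ} (hμ : 0 < μ) (a b : ℝ) :
    ∫ x in a..b, f' x / (f x ^ 2 + μ ^ 2) ≤ Real.pi / μ := by
  have hcf : Continuous f := continuous_iff_continuousAt.2 fun x => (hf x).continuousAt
  have hden : ∀ x, f x ^ 2 + μ ^ 2 ≠ 0 := fun x => by positivity
  have hatan : ∫ x in a..b, f' x / (f x ^ 2 + μ ^ 2) =
      μ⁻¹ * Real.arctan (f b / μ) - μ⁻¹ * Real.arctan (f a / μ) := by
    refine intervalIntegral.integral_eq_sub_of_hasDerivAt
      (f := fun x => μ⁻¹ * Real.arctan (f x / μ)) (fun x _ => ?_)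
      ((hc.div (by fun_prop) hden).intervalIntegrable _ _)
    refine ((((hf x).div_const μ).arctan).const_mul μ⁻¹).congr_deriv ?_
    have := hden x
    have h2 : 1 + (f x / μ) ^ 2 = (f x ^ 2 + μ ^ 2) / μ ^ 2 := by field_simp; ring
    rw [h2]
    field_simp
  rw [hatan, ← mul_sub, div_eq_inv_mul Real.pi]
  gcongr
  linarith [Real.arctan_lt_pi_div_two (f b / μ), Real.neg_pi_div_two_lt_arctan (f a / μ)]

/-- A regularised first derivative test for oscillatory integrals with convex phase. -/
theorem norm_integral_exp_phase_le {φ φ' φ'' : ℝ → ℝ} (hφ : ∀ x, HasDerivAt φ (φ' x) x)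
    (hφ' : ∀ x, HasDerivAt φ' (φ'' x) x) (hc : Continuous φ'') {a b μ : ℝ} (hab : a ≤ b)
    (hμ : 0 < μ) (hpos : ∀ x ∈ Set.Icc a b, 0 ≤ φ'' x) :
    ‖∫ x in a..b, Complex.exp (φ x * Complex.I)‖ ≤
      (1 + Real.pi) / μ + ∫ x in a..b, μ ^ 2 / (φ' x ^ 2 + μ ^ 2) := by
  have hcφ : Continuous φ := continuous_iff_continuousAt.2 fun x => (hφ x).continuousAt
  have hcφ' : Continuous φ' := continuous_iff_continuousAt.2 fun x => (hφ' x).continuousAt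
  have hden : ∀ x, 0 < φ' x ^ 2 + μ ^ 2 := fun x => by positivity
  have hden' : ∀ x, φ' x ^ 2 + μ ^ 2 ≠ 0 := fun x => (hden x).ne'
  -- Write 1 = ψ φ' + μ² / (φ'² + μ²). The first term is integrated by parts; ψ replaces 1 / φ' and
  -- stays bounded at stationary points. Convexity of φ bounds the variation of ψ by an arctangent
  -- integral.
  set ψ : ℝ → ℝ := fun x => φ' x / (φ' x ^ 2 + μ ^ 2) with hψ
  set ψ' : ℝ → ℝ := fun x => φ'' x * (μ ^ 2 - φ' x ^ 2) / (φ' x ^ 2 + μ ^ 2) ^ 2 with hψ'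
  have hdψ : ∀ x, HasDerivAt ψ (ψ' x) x := by
    intro x
    refine ((hφ' x).fun_div (((hφ' x).fun_pow 2).add_const (μ ^ 2)) (hden' x)).congr_deriv ?_
    simp only [hψ']
    congr 1
    push_cast
    ring
  have hcψ' : Continuous ψ' := by
    simp only [hψ']
    exact (hc.mul (by fun_prop)).div (by fun_prop) fun x => pow_ne_zero 2 (hden' x)
  have hcψ : Continuous ψ := continuous_iff_continuousAt.2 fun x => (hdψ x).continuousAt
  set E : ℝ → ℂ := fun x => Complex.exp (φ x * Complex.I) with hE
  have hnE : ∀ x, ‖E x‖ = 1 := fun x => Complex.norm_exp_ofReal_mul_I _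
  have hcE : Continuous E := by simp only [hE]; fun_prop
  have hdE : ∀ x, HasDerivAt E (E x * (φ' x * Complex.I)) x := fun x =>
    (((hφ x).ofReal_comp).mul_const Complex.I).cexp
  have hψb : ∀ x, |ψ x| ≤ 1 / (2 * μ) := by
    intro x
    simp only [hψ]
    rw [abs_div, abs_of_pos (hden x), div_le_div_iff₀ (hden x) (by positivity)]
    nlinarith [sq_nonneg (|φ' x| - μ), sq_abs (φ' x)]
  have hparts := intervalIntegral.integral_mul_deriv_eq_deriv_mul (a := a) (b := b)
    (u := fun x => (ψ x : ℂ)) (u' := fun x => (ψ' x : ℂ)) (v := E)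
    (v' := fun x => E x * (φ' x * Complex.I)) (fun x _ => (hdψ x).ofReal_comp)
    (fun x _ => hdE x) ((by fun_prop : Continuous fun x => (ψ' x : ℂ)).intervalIntegrable _ _)
    ((by fun_prop : Continuous fun x => E x * (φ' x * Complex.I)).intervalIntegrable _ _)
  have hcrem : Continuous fun x => μ ^ 2 / (φ' x ^ 2 + μ ^ 2) :=
    continuous_const.div (by fun_prop) hden'
  have hsplit : ∫ x in a..b, E x =
      (-Complex.I) * (∫ x in a..b, (ψ x : ℂ) * (E x * (φ' x * Complex.I))) +
        ∫ x in a..b, E x * ((μ ^ 2 / (φ' x ^ 2 + μ ^ 2) : ℝ) : ℂ) := by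
    rw [← intervalIntegral.integral_const_mul, ← intervalIntegral.integral_add
      (Continuous.intervalIntegrable (by fun_prop) _ _)
      (Continuous.intervalIntegrable (by fun_prop) _ _)]
    refine intervalIntegral.integral_congr fun x _ => ?_
    have h1 : ((ψ x * φ' x + μ ^ 2 / (φ' x ^ 2 + μ ^ 2) : ℝ) : ℂ) = 1 := by
      rw [Complex.ofReal_eq_one]
      simp only [hψ]
      field_simp [hden' x]
    push_cast at h1 ⊢
    linear_combination (-(E x)) * h1 + E x * ψ x * φ' x * Complex.I_mul_I
  have hrem : ‖∫ x in a..b, E x * ((μ ^ 2 / (φ' x ^ 2 + μ ^ 2) : ℝ) : ℂ)‖ ≤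
      ∫ x in a..b, μ ^ 2 / (φ' x ^ 2 + μ ^ 2) := by
    refine intervalIntegral.norm_integral_le_of_norm_le hab (.of_forall fun x _ => ?_)
      (hcrem.intervalIntegrable _ _)
    rw [norm_mul, hnE, one_mul, Complex.norm_real, Real.norm_of_nonneg (by positivity)]
  have hbd : ∀ x, ‖(ψ x : ℂ) * E x‖ ≤ 1 / (2 * μ) := fun x => by
    rw [norm_mul, hnE, mul_one, Complex.norm_real]
    exact hψb x
  have hvar : ‖∫ x in a..b, (ψ' x : ℂ) * E x‖ ≤ Real.pi / μ := by
    have h3 : ‖∫ x in a..b, (ψ' x : ℂ) * E x‖ ≤ ∫ x in a..b, φ'' x / (φ' x ^ 2 + μ ^ 2) := by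
      refine intervalIntegral.norm_integral_le_of_norm_le hab (.of_forall fun x hx => ?_)
        ((hc.div (by fun_prop) hden').intervalIntegrable _ _)
      have h4 := hpos x ⟨hx.1.le, hx.2⟩
      rw [norm_mul, hnE, mul_one, Complex.norm_real, Real.norm_eq_abs]
      simp only [hψ']
      rw [abs_div, abs_mul, abs_of_nonneg h4, abs_of_pos (pow_pos (hden x) 2),
        div_le_div_iff₀ (pow_pos (hden x) 2) (hden x), sq (φ' x ^ 2 + μ ^ 2), mul_assoc]
      have h5 : |μ ^ 2 - φ' x ^ 2| ≤ φ' x ^ 2 + μ ^ 2 := by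
        rw [abs_le]; constructor <;> nlinarith [sq_nonneg μ, sq_nonneg (φ' x)]
      gcongr
    exact h3.trans (integral_deriv_div_sq_add_sq_le hφ' hc hμ a b)
  rw [hsplit, hparts]
  refine (norm_add_le _ _).trans (add_le_add ?_ hrem)
  rw [norm_mul, norm_neg, Complex.norm_I, one_mul]
  refine (norm_sub_le _ _).trans ?_
  refine (add_le_add ((norm_sub_le _ _).trans (add_le_add (hbd b) (hbd a))) hvar).trans_eq ?_
  field_simp
  ring

/-- When the cosine is small, |sin θ| ≥ 1 - s². If |m| ≤ t, this costs t s², half of the gap t -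
|m|; if |m| ≥ t, |sin θ| ≤ 1 suffices. -/
theorem le_abs_mul_sin_add_of_cos_lt {t m s θ : ℝ} (ht : 0 < t)
    (hs : s ^ 2 = |(t - |m|)| / 2 / t) (hc0 : 0 ≤ Real.cos θ) (hcs : Real.cos θ < s) :
    |(t - |m|)| / 2 ≤ |t * Real.sin θ + m| := by
  have h1 : |t * Real.sin θ| - |m| ≤ |t * Real.sin θ + m| := by
    have := abs_sub_abs_le_abs_sub (t * Real.sin θ) (-m)
    rwa [abs_neg, sub_neg_eq_add] at this
  have h2 : |m| - |t * Real.sin θ| ≤ |t * Real.sin θ + m| := by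
    have := abs_sub_abs_le_abs_sub m (-(t * Real.sin θ))
    rwa [abs_neg, sub_neg_eq_add, add_comm m] at this
  rw [abs_mul, abs_of_pos ht] at h1 h2
  have hsin : |Real.sin θ| ≤ 1 := Real.abs_sin_le_one θ
  rcases le_total |m| t with hm | hm
  · rw [abs_of_nonneg (sub_nonneg.2 hm)] at hs ⊢
    have h3 : Real.cos θ ^ 2 < s ^ 2 := by gcongr
    have h4 : 1 - s ^ 2 ≤ |Real.sin θ| := by
      nlinarith [Real.sin_sq_add_cos_sq θ, sq_abs (Real.sin θ), abs_nonneg (Real.sin θ)]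
    have h5 : t * s ^ 2 = (t - |m|) / 2 := by rw [hs]; field_simp
    nlinarith
  · rw [abs_of_nonpos (sub_nonpos.2 hm)] at hs ⊢
    nlinarith

theorem integral_le_linear_combination {f g₀ g₁ g₂ : ℝ → ℝ} {a b A B : ℝ} (hab : a ≤ b)
    (hf : Continuous f) (h₀ : Continuous g₀) (h₁ : Continuous g₁) (h₂ : Continuous g₂)
    (h : ∀ x ∈ Set.Icc a b, f x ≤ A * g₀ x + (B * g₁ x + B * g₂ x)) :
    ∫ x in a..b, f x ≤
      A * (∫ x in a..b, g₀ x) + (B * (∫ x in a..b, g₁ x) + B * ∫ x in a..b, g₂ x) := by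
  have hle := intervalIntegral.integral_mono_on (μ := volume) hab (hf.intervalIntegrable _ _)
    (Continuous.intervalIntegrable (u := fun x => A * g₀ x + (B * g₁ x + B * g₂ x))
      (by fun_prop) _ _) h
  rwa [intervalIntegral.integral_add (Continuous.intervalIntegrable (by fun_prop) _ _)
    (Continuous.intervalIntegrable (by fun_prop) _ _), intervalIntegral.integral_add
    (Continuous.intervalIntegrable (by fun_prop) _ _)
    (Continuous.intervalIntegrable (by fun_prop) _ _), intervalIntegral.integral_const_mul,
    intervalIntegral.integral_const_mul, intervalIntegral.integral_const_mul] at hle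

theorem integral_lorentzian_sin_le {t m μ : ℝ} (ht : 0 < t) (hm : t ≠ |m|) (hμ : 0 < μ) :
    ∫ θ in -(Real.pi / 2)..Real.pi / 2, μ ^ 2 / ((t * Real.sin θ + m) ^ 2 + μ ^ 2) ≤
      14 * μ / √(|(t - |m|)| / 2 * t) := by
  set h := |(t - |m|)| / 2 with hh
  have hh0 : 0 < h := by have := abs_pos.2 (sub_ne_zero.2 hm); positivity
  -- The threshold for cos θ that balances the two regions, since s t = h / s = √(h t).
  set s := √(h / t) with hs
  have hs0 : 0 < s := Real.sqrt_pos.2 (by positivity)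
  have hs2 : s ^ 2 = h / t := Real.sq_sqrt (by positivity)
  have hpi := Real.pi_pos
  set f : ℝ → ℝ := fun θ => t * Real.sin θ + m with hf
  have hfd : ∀ θ, HasDerivAt f (t * Real.cos θ) θ := fun θ =>
    ((Real.hasDerivAt_sin θ).const_mul t).add_const m
  have hd1 : ∀ θ : ℝ, HasDerivAt (fun θ => 2 / Real.pi * θ - 1) (2 / Real.pi) θ := fun θ => by
    simpa using ((hasDerivAt_id θ).const_mul (2 / Real.pi)).sub_const 1
  have hd2 : ∀ θ : ℝ, HasDerivAt (fun θ => 2 / Real.pi * θ + 1) (2 / Real.pi) θ := fun θ => by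
    simpa using ((hasDerivAt_id θ).const_mul (2 / Real.pi)).add_const 1
  have hcf : Continuous f := by fun_prop
  have e0 : ∀ θ, f θ ^ 2 + μ ^ 2 ≠ 0 := fun θ => by positivity
  have e1 : ∀ θ : ℝ, (2 / Real.pi * θ - 1) ^ 2 + s ^ 2 ≠ 0 := fun θ => by positivity
  have e2 : ∀ θ : ℝ, (2 / Real.pi * θ + 1) ^ 2 + s ^ 2 ≠ 0 := fun θ => by positivity
  have c0 : Continuous fun θ => (t * Real.cos θ) / (f θ ^ 2 + μ ^ 2) :=
    (by fun_prop : Continuous fun θ => t * Real.cos θ).div (by fun_prop) e0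
  have c1 : Continuous fun θ : ℝ => (2 / Real.pi) / ((2 / Real.pi * θ - 1) ^ 2 + s ^ 2) :=
    continuous_const.div (by fun_prop) e1
  have c2 : Continuous fun θ : ℝ => (2 / Real.pi) / ((2 / Real.pi * θ + 1) ^ 2 + s ^ 2) :=
    continuous_const.div (by fun_prop) e2
  have cl : Continuous fun θ => μ ^ 2 / (f θ ^ 2 + μ ^ 2) := continuous_const.div (by fun_prop) e0
  have i0 := integral_deriv_div_sq_add_sq_le hfd (by fun_prop) hμ (-(Real.pi / 2)) (Real.pi / 2)
  have i1 := integral_deriv_div_sq_add_sq_le hd1 (by fun_prop) hs0 (-(Real.pi / 2)) (Real.pi / 2)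
  have i2 := integral_deriv_div_sq_add_sq_le hd2 (by fun_prop) hs0 (-(Real.pi / 2)) (Real.pi / 2)
  -- A serves cos θ ≥ s, where the derivative t cos θ can be inserted at a cost. B serves cos θ < s,
  -- where the integrand is at most μ / (2h) and Jordan's inequality puts θ within π s / 2 of an
  -- endpoint; Lorentzians of width s replace the indicator.
  set A := μ ^ 2 / (s * t) with hA
  set B := μ / (2 * h) * (Real.pi * s ^ 2) with hB
  have hpt : ∀ θ ∈ Set.Icc (-(Real.pi / 2)) (Real.pi / 2), μ ^ 2 / (f θ ^ 2 + μ ^ 2) ≤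
      A * ((t * Real.cos θ) / (f θ ^ 2 + μ ^ 2)) +
        (B * ((2 / Real.pi) / ((2 / Real.pi * θ - 1) ^ 2 + s ^ 2)) +
          B * ((2 / Real.pi) / ((2 / Real.pi * θ + 1) ^ 2 + s ^ 2))) := by
    intro θ hθ
    have hcos : 0 ≤ Real.cos θ := Real.cos_nonneg_of_mem_Icc hθ
    have n0 : 0 ≤ A * ((t * Real.cos θ) / (f θ ^ 2 + μ ^ 2)) := by positivity
    have n1 : 0 ≤ B * ((2 / Real.pi) / ((2 / Real.pi * θ - 1) ^ 2 + s ^ 2)) := by positivity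
    have n2 : 0 ≤ B * ((2 / Real.pi) / ((2 / Real.pi * θ + 1) ^ 2 + s ^ 2)) := by positivity
    rcases le_or_gt s (Real.cos θ) with hc | hc
    · have : μ ^ 2 / (f θ ^ 2 + μ ^ 2) ≤ A * ((t * Real.cos θ) / (f θ ^ 2 + μ ^ 2)) := by
        rw [← mul_div_assoc]
        gcongr
        rw [hA, div_mul_eq_mul_div, le_div_iff₀ (by positivity)]
        have : s * t ≤ t * Real.cos θ := by nlinarith
        gcongr
      linarith
    · have hfh := le_abs_mul_sin_add_of_cos_lt ht hs2 hcos hc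
      have l1 : μ ^ 2 / (f θ ^ 2 + μ ^ 2) ≤ μ / (2 * h) := by
        rw [div_le_div_iff₀ (by positivity) (by positivity)]
        have h6 : h * (2 * μ) ≤ f θ ^ 2 + μ ^ 2 := by
          have h7 : h * (2 * μ) ≤ |f θ| * (2 * μ) := by gcongr
          nlinarith [sq_nonneg (|f θ| - μ), sq_abs (f θ)]
        nlinarith
      have key : ∀ x : ℝ, x ^ 2 ≤ s ^ 2 → μ / (2 * h) ≤ B * ((2 / Real.pi) / (x ^ 2 + s ^ 2)) := by
        intro x hx
        have : B * ((2 / Real.pi) / (x ^ 2 + s ^ 2)) =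
            μ / (2 * h) * (2 * s ^ 2 / (x ^ 2 + s ^ 2)) := by
          rw [hB]; field_simp
        rw [this]
        refine le_mul_of_one_le_right (by positivity) ?_
        rw [one_le_div (by positivity)]
        linarith
      rcases le_total 0 θ with h0 | h0
      · have h8 := Real.one_sub_mul_le_cos h0 hθ.2
        have h9 : 2 / Real.pi * θ ≤ 1 := by
          rw [div_mul_eq_mul_div, div_le_one hpi]; linarith [hθ.2]
        have := key (2 / Real.pi * θ - 1) (by
          apply sq_le_sq' <;> linarith)
        linarith
      · have h8 := Real.one_add_mul_le_cos hθ.1 h0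
        have h9 : -1 ≤ 2 / Real.pi * θ := by
          rw [div_mul_eq_mul_div, le_div_iff₀ hpi]; linarith [hθ.1]
        have := key (2 / Real.pi * θ + 1) (by
          apply sq_le_sq' <;> linarith)
        linarith
  have hle := integral_le_linear_combination (by linarith : -(Real.pi / 2) ≤ Real.pi / 2)
    cl c0 c1 c2 hpt
  have hA0 : 0 ≤ A := by positivity
  have hB0 : 0 ≤ B := by positivity
  refine hle.trans ?_
  have hst : √(h * t) = s * t := by
    rw [Real.sqrt_eq_iff_mul_self_eq (by positivity) (by positivity)]
    have : s * t * (s * t) = s ^ 2 * t ^ 2 := by ring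
    rw [this, hs2]; field_simp
  rw [hst]
  have hfin : A * (Real.pi / μ) + (B * (Real.pi / s) + B * (Real.pi / s)) =
      (Real.pi + Real.pi ^ 2) * (μ / (s * t)) := by
    have : s * t = h / s := by rw [eq_div_iff hs0.ne']; rw [mul_right_comm, ← sq, hs2]; field_simp
    rw [hA, hB, this]
    field_simp
    ring
  calc _ ≤ A * (Real.pi / μ) + (B * (Real.pi / s) + B * (Real.pi / s)) := by gcongr
    _ = (Real.pi + Real.pi ^ 2) * (μ / (s * t)) := hfin
    _ ≤ 14 * (μ / (s * t)) := by
        gcongr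
        nlinarith [Real.pi_lt_d2]
    _ = _ := by ring

/-- Stationary phase bound, uniform up to the turning point `t = |m|`. -/
theorem norm_integral_exp_cos_le {t m : ℝ} (ht : 0 < t) (hm : t ≠ |m|) :
    ‖∫ θ in -(Real.pi / 2)..Real.pi / 2,
        Complex.exp ((m * θ - t * Real.cos θ : ℝ) * Complex.I)‖ ≤
      19 * (|(t - |m|)| / 2 * t) ^ (-(1 / 4) : ℝ) := by
  have hpi := Real.pi_pos
  set X := |(t - |m|)| / 2 * t with hX
  have hX0 : 0 < X := by have := abs_pos.2 (sub_ne_zero.2 hm); positivity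
  -- This makes both error terms multiples of 1 / μ, with total constant 1 + π + 14 ≤ 19.
  set μ := X ^ (1 / 4 : ℝ) with hμ
  have hμ0 : 0 < μ := by positivity
  have hμ2 : √X = μ ^ 2 := by
    rw [hμ, ← Real.rpow_natCast, ← Real.rpow_mul hX0.le, Real.sqrt_eq_rpow]; norm_num
  have h1 := norm_integral_exp_phase_le (φ := fun θ => m * θ - t * Real.cos θ)
    (φ' := fun θ => t * Real.sin θ + m) (φ'' := fun θ => t * Real.cos θ)
    (fun x => by
      refine (((hasDerivAt_id x).const_mul m).sub
        ((Real.hasDerivAt_cos x).const_mul t)).congr_deriv ?_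
      simp; ring)
    (fun x => ((Real.hasDerivAt_sin x).const_mul t).add_const m) (by fun_prop)
    (by linarith : -(Real.pi / 2) ≤ Real.pi / 2) hμ0
    (fun x hx => mul_nonneg ht.le (Real.cos_nonneg_of_mem_Icc hx))
  have h2 := integral_lorentzian_sin_le ht hm hμ0
  rw [hμ2] at h2
  refine h1.trans ((add_le_add_right h2 _).trans ?_)
  rw [Real.rpow_neg hX0.le, ← hμ]
  have : 14 * μ / μ ^ 2 = 14 / μ := by field_simp
  rw [this, ← add_div, div_eq_mul_inv]
  gcongr
  linarith [Real.pi_lt_d2]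

/-! ### Bessel coefficients -/

theorem cosTwoPi_coe (x : ℝ) : cosTwoPi (x : UnitAddCircle) = Real.cos (2 * Real.pi * x) := rfl

theorem continuous_cosTwoPi : Continuous cosTwoPi :=
  continuous_coinduced_dom.2 (by
    change Continuous fun x : ℝ => Real.cos (2 * Real.pi * x)
    fun_prop)

theorem abs_cosTwoPi_le_one (x : UnitAddCircle) : |cosTwoPi x| ≤ 1 := by
  induction x using QuotientAddGroup.induction_on with
  | H x => exact Real.abs_cos_le_one _

theorem cosTwoPi_neg (x : UnitAddCircle) : cosTwoPi (-x) = cosTwoPi x := by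
  induction x using QuotientAddGroup.induction_on with
  | H x =>
    change Real.cos (2 * Real.pi * -x) = Real.cos (2 * Real.pi * x)
    rw [mul_neg, Real.cos_neg]

theorem cosTwoPi_eq_fourier (x : UnitAddCircle) :
    (cosTwoPi x : ℂ) = (fourier 1 x + fourier (-1) x) / 2 := by
  induction x using QuotientAddGroup.induction_on with
  | H x =>
    rw [fourier_coe_apply, fourier_coe_apply, cosTwoPi_coe, Complex.ofReal_cos, Complex.cos]
    push_cast
    congr 3 <;> ring_nf

/-- The Bessel coefficients: the Fourier coefficients of `x ↦ exp (i t cos (2 π x))`. -/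
noncomputable def besselCoeff (m : ℤ) (t : ℝ) : ℂ :=
  fourierCoeff (fun x : UnitAddCircle => Complex.exp ((t * cosTwoPi x : ℝ) * Complex.I)) m

theorem besselCoeff_eq_integral (m : ℤ) (t : ℝ) :
    besselCoeff m t = ∫ x : UnitAddCircle,
      fourier (-m) x * Complex.exp ((t * cosTwoPi x : ℝ) * Complex.I) ∂AddCircle.haarAddCircle :=
  rfl

theorem norm_fourier_apply (m : ℤ) (x : UnitAddCircle) : ‖fourier m x‖ = 1 := by
  rw [fourier_apply, Circle.norm_coe]

theorem norm_besselCoeff_neg (m : ℤ) (t : ℝ) : ‖besselCoeff m (-t)‖ = ‖besselCoeff (-m) t‖ := by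
  rw [besselCoeff_eq_integral, besselCoeff_eq_integral, ← Complex.norm_conj, ← integral_conj]
  congr 1
  refine integral_congr_ae (.of_forall fun x => ?_)
  simp only [map_mul, ← fourier_neg, ← Complex.exp_conj, Complex.conj_ofReal, Complex.conj_I]
  push_cast
  ring_nf

theorem norm_besselCoeff_le_one (m : ℤ) (t : ℝ) : ‖besselCoeff m t‖ ≤ 1 := by
  rw [besselCoeff_eq_integral]
  refine (norm_integral_le_of_norm_le_const (C := 1) (.of_forall fun x => ?_)).trans_eq (by simp)
  rw [norm_mul, norm_fourier_apply, Complex.norm_exp_ofReal_mul_I, one_mul]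

theorem besselCoeff_eq_intervalIntegral (m : ℤ) (t : ℝ) :
    besselCoeff m t = ((2 * Real.pi)⁻¹ : ℝ) • ∫ θ in -(Real.pi / 2)..3 * Real.pi / 2,
      Complex.exp ((t * Real.cos θ - m * θ : ℝ) * Complex.I) := by
  have hpi := Real.pi_pos
  -- Starting the period at -1/4 makes the interval split into two halves on which the cosine has
  -- constant sign. The shift by π later maps the second half to the first with m replaced by -m.
  rw [besselCoeff, fourierCoeff_eq_intervalIntegral _ m (-1 / 4)]
  have h := intervalIntegral.integral_comp_mul_left (a := -1 / 4) (b := -1 / 4 + 1)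
    (fun θ : ℝ => Complex.exp ((t * Real.cos θ - m * θ : ℝ) * Complex.I))
    (c := 2 * Real.pi) (by positivity)
  rw [show 2 * Real.pi * (-1 / 4) = -(Real.pi / 2) by ring,
    show 2 * Real.pi * (-1 / 4 + 1) = 3 * Real.pi / 2 by ring] at h
  rw [← h, div_one, one_smul]
  refine intervalIntegral.integral_congr fun x _ => ?_
  simp only [fourier_coe_apply, cosTwoPi_coe, smul_eq_mul, ← Complex.exp_add]
  congr 1
  push_cast
  ring

theorem norm_besselCoeff_le_of_pos {m : ℤ} {t : ℝ} (ht : 0 < t) (hm : t ≠ |(m : ℝ)|) :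
    ‖besselCoeff m t‖ ≤ 7 * (|(t - |(m : ℝ)|)| / 2 * t) ^ (-(1 / 4) : ℝ) := by
  have hpi := Real.pi_pos
  set K : ℝ → ℂ := fun m => ∫ θ in -(Real.pi / 2)..Real.pi / 2,
    Complex.exp ((m * θ - t * Real.cos θ : ℝ) * Complex.I) with hK
  have hc : Continuous fun θ : ℝ => Complex.exp ((t * Real.cos θ - m * θ : ℝ) * Complex.I) := by
    fun_prop
  have h1 : ‖∫ θ in -(Real.pi / 2)..Real.pi / 2,
      Complex.exp ((t * Real.cos θ - m * θ : ℝ) * Complex.I)‖ = ‖K m‖ := by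
    rw [hK, ← Complex.norm_conj]
    simp only
    rw [intervalIntegral.integral_of_le (by linarith), intervalIntegral.integral_of_le
      (by linarith), ← integral_conj]
    congr 1
    refine integral_congr_ae (.of_forall fun x => ?_)
    simp only [← Complex.exp_conj, map_mul, Complex.conj_ofReal, Complex.conj_I]
    push_cast
    ring_nf
  have h2 : ‖∫ θ in Real.pi / 2..3 * Real.pi / 2,
      Complex.exp ((t * Real.cos θ - m * θ : ℝ) * Complex.I)‖ = ‖K (-m)‖ := by
    have := intervalIntegral.integral_comp_add_right (a := -(Real.pi / 2)) (b := Real.pi / 2)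
      (fun θ : ℝ => Complex.exp ((t * Real.cos θ - m * θ : ℝ) * Complex.I)) Real.pi
    rw [show -(Real.pi / 2) + Real.pi = Real.pi / 2 by ring,
      show Real.pi / 2 + Real.pi = 3 * Real.pi / 2 by ring] at this
    rw [← this]
    have h3 : ∀ θ : ℝ, Complex.exp ((t * Real.cos (θ + Real.pi) - m * (θ + Real.pi) : ℝ) *
        Complex.I) = Complex.exp ((-(m * Real.pi) : ℝ) * Complex.I) *
          Complex.exp ((-m * θ - t * Real.cos θ : ℝ) * Complex.I) := by
      intro θ
      rw [Real.cos_add_pi, ← Complex.exp_add]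
      congr 1
      push_cast
      ring
    simp only [h3]
    rw [intervalIntegral.integral_const_mul, norm_mul, Complex.norm_exp_ofReal_mul_I, one_mul]
  have b1 := norm_integral_exp_cos_le ht hm
  have b2 := norm_integral_exp_cos_le (m := -m) ht (by rwa [abs_neg])
  rw [abs_neg] at b2
  rw [besselCoeff_eq_intervalIntegral, ← intervalIntegral.integral_add_adjacent_intervals
    (hc.intervalIntegrable _ (Real.pi / 2)) (hc.intervalIntegrable _ _), norm_smul,
    Real.norm_of_nonneg (by positivity)]
  set X := (|(t - |(m : ℝ)|)| / 2 * t) ^ (-(1 / 4) : ℝ) with hX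
  have hX0 : 0 ≤ X := by positivity
  calc _ ≤ (2 * Real.pi)⁻¹ * (19 * X + 19 * X) := by
        gcongr
        refine (norm_add_le _ _).trans (add_le_add (h1.trans_le b1) (h2.trans_le b2))
    _ ≤ 7 * X := by
        rw [inv_mul_le_iff₀ (by positivity)]
        nlinarith [Real.pi_gt_three]

theorem norm_besselCoeff_le {m : ℤ} {t : ℝ} (ht : t ≠ 0) (hm : |t| ≠ |(m : ℝ)|) :
    ‖besselCoeff m t‖ ≤ 7 * (|(|t| - |(m : ℝ)|)| / 2 * |t|) ^ (-(1 / 4) : ℝ) := by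
  rcases lt_or_gt_of_ne ht with h | h
  · rw [abs_of_neg h] at hm ⊢
    have := norm_besselCoeff_neg m (-t)
    rw [neg_neg] at this
    rw [this]
    have h2 : |((-m : ℤ) : ℝ)| = |(m : ℝ)| := by push_cast; exact abs_neg _
    simpa only [h2] using norm_besselCoeff_le_of_pos (m := -m) (neg_pos.2 h) (by rwa [h2])
  · rw [abs_of_pos h] at hm ⊢
    exact norm_besselCoeff_le_of_pos h hm

/-- The k-th power of the cosine is a trigonometric polynomial of degree k: each factor shifts the
frequency by ±1. -/
theorem integral_fourier_mul_cosTwoPi_pow (k : ℕ) {m : ℤ} (hkm : (k : ℤ) < |m|) :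
    ∫ x : UnitAddCircle, fourier m x * (cosTwoPi x : ℂ) ^ k ∂AddCircle.haarAddCircle = 0 := by
  have hcc := continuous_cosTwoPi
  induction k generalizing m with
  | zero =>
    have h := congrFun (fourierCoeff_fourier (T := 1) 0) (-m)
    rw [fourierCoeff, Pi.single_apply, if_neg (by rintro h; simp_all)] at h
    simpa using h
  | succ k ih =>
    have h1 : |m| ≤ |m + 1| + 1 := by
      have := abs_sub (m + 1) 1; simpa using this
    have h2 : |m| ≤ |m + -1| + 1 := by
      have := abs_sub (m + -1) (-1); simpa using this
    push_cast at hkm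
    have e1 := ih (m := m + 1) (by linarith)
    have e2 := ih (m := m + -1) (by linarith)
    have hi : ∀ n : ℤ, Integrable (fun x : UnitAddCircle => fourier n x * (cosTwoPi x : ℂ) ^ k)
        AddCircle.haarAddCircle := fun n =>
      Continuous.integrable_of_hasCompactSupport (by fun_prop) (.of_compactSpace _)
    calc _ = ∫ x : UnitAddCircle, (1 / 2 : ℂ) * (fourier (m + 1) x * (cosTwoPi x : ℂ) ^ k +
          fourier (m + -1) x * (cosTwoPi x : ℂ) ^ k) ∂AddCircle.haarAddCircle := by
            refine integral_congr_ae (.of_forall fun x => ?_)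
            simp only [fourier_add, pow_succ]
            nth_rewrite 2 [cosTwoPi_eq_fourier]
            ring
      _ = 0 := by
            rw [integral_const_mul, integral_add (hi _) (hi _), e1, e2]
            simp

/-- The Taylor terms of the exponential of order below |m| are orthogonal to the m-th character, so
only the Taylor remainder contributes. -/
theorem norm_besselCoeff_le_pow_div_factorial {m : ℤ} {t : ℝ}
    (ht : |t| ≤ (m.natAbs + 1 : ℝ) / 2) :
    ‖besselCoeff m t‖ ≤ |t| ^ m.natAbs / m.natAbs.factorial * 2 := by
  have hcc := continuous_cosTwoPi
  set M := m.natAbs with hM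
  have hz : ∫ x : UnitAddCircle, fourier (-m) x * ∑ k ∈ Finset.range M,
      (((t * cosTwoPi x : ℝ) * Complex.I) ^ k / k.factorial) ∂AddCircle.haarAddCircle = 0 := by
    simp only [Finset.mul_sum]
    rw [integral_finsetSum _ fun k _ => Continuous.integrable_of_hasCompactSupport
      (by fun_prop) (.of_compactSpace _)]
    refine Finset.sum_eq_zero fun k hk => ?_
    have h0 := integral_fourier_mul_cosTwoPi_pow k (m := -m) (by
      have := Finset.mem_range.1 hk
      rw [abs_neg, Int.abs_eq_natAbs]; omega)
    calc _ = ∫ x : UnitAddCircle, ((t * Complex.I) ^ k / k.factorial) *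
          (fourier (-m) x * (cosTwoPi x : ℂ) ^ k) ∂AddCircle.haarAddCircle := by
            refine integral_congr_ae (.of_forall fun x => ?_)
            simp only
            push_cast
            ring
      _ = 0 := by rw [integral_const_mul, h0, mul_zero]
  have hsub : besselCoeff m t = ∫ x : UnitAddCircle, fourier (-m) x *
      (Complex.exp ((t * cosTwoPi x : ℝ) * Complex.I) - ∑ k ∈ Finset.range M,
      (((t * cosTwoPi x : ℝ) * Complex.I) ^ k / k.factorial)) ∂AddCircle.haarAddCircle := by
    simp only [mul_sub]
    rw [integral_sub, hz, sub_zero, besselCoeff_eq_integral] <;>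
    exact Continuous.integrable_of_hasCompactSupport (by fun_prop) (.of_compactSpace _)
  rw [hsub]
  refine (norm_integral_le_of_norm_le_const (.of_forall fun x => ?_)).trans_eq
    (by rw [probReal_univ, mul_one])
  have hn : ‖((t * cosTwoPi x : ℝ) * Complex.I : ℂ)‖ ≤ |t| := by
    rw [norm_mul, Complex.norm_I, mul_one, Complex.norm_real, Real.norm_eq_abs, abs_mul]
    exact mul_le_of_le_one_right (abs_nonneg _) (abs_cosTwoPi_le_one x)
  rw [norm_mul, norm_fourier_apply, one_mul]
  refine (Complex.exp_bound' ?_).trans (by gcongr)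
  rw [div_le_iff₀ (by positivity), Nat.cast_succ]
  linarith

theorem succ_sq_le_mul_pow (M : ℕ) : ((M : ℝ) + 1) ^ 2 ≤ 4 * (8 / 3) ^ M := by
  induction M with
  | zero => norm_num
  | succ k ih =>
    rw [pow_succ (8 / 3 : ℝ)]
    push_cast
    rcases k.eq_zero_or_pos with rfl | hk
    · norm_num
    · have : (1 : ℝ) ≤ k := by exact_mod_cast hk
      nlinarith

/-- Since M^M / M! ≤ e^M ≤ 3^M, the Taylor bound at |t| ≤ M / 8 is geometric with ratio 3/8, which
beats the square. This covers times well before the turning point. -/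
theorem norm_besselCoeff_le_of_small {m : ℤ} {t : ℝ} (ht : |t| ≤ (1 + |(m : ℝ)|) / 16) :
    ‖besselCoeff m t‖ ≤ 8 / (1 + |(m : ℝ)|) ^ 2 := by
  have hM : |(m : ℝ)| = (m.natAbs : ℝ) := by
    rw [Nat.cast_natAbs, Int.cast_abs]
  rw [hM] at ht ⊢
  have h0 := norm_besselCoeff_le_pow_div_factorial (m := m) (t := t) (by linarith [abs_nonneg t])
  set M := m.natAbs
  rcases M.eq_zero_or_pos with hz | hpos
  · rw [hz]
    exact (norm_besselCoeff_le_one m t).trans (by norm_num)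
  have h1 : (1 : ℝ) ≤ M := by exact_mod_cast hpos
  have ht' : |t| ≤ M / 8 := by linarith
  have he : Real.exp M ≤ 3 ^ M := by
    rw [← Real.exp_one_pow]
    exact pow_le_pow_left₀ (Real.exp_pos 1).le (by linarith [Real.exp_one_lt_d9]) _
  have h2 : |t| ^ M / M.factorial ≤ (3 / 8) ^ M := by
    calc |t| ^ M / M.factorial ≤ (M / 8 : ℝ) ^ M / M.factorial := by gcongr
      _ = ((M : ℝ) ^ M / M.factorial) / 8 ^ M := by rw [div_pow]; ring
      _ ≤ 3 ^ M / 8 ^ M := by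
          gcongr
          exact (Real.pow_div_factorial_le_exp _ (by positivity) M).trans he
      _ = _ := by rw [div_pow]
  refine h0.trans ((mul_le_mul_of_nonneg_right h2 zero_le_two).trans ?_)
  rw [le_div_iff₀ (by positivity)]
  have h3 := succ_sq_le_mul_pow M
  have h4 : (3 / 8 : ℝ) ^ M * (8 / 3) ^ M = 1 := by rw [← mul_pow]; norm_num
  have h5 : (0 : ℝ) < (3 / 8) ^ M := by positivity
  nlinarith

/-! ### Time integrals of Bessel products -/

theorem lintegral_Ioc_rpow_neg_three_quarters {M : ℝ} (hM : 0 ≤ M) :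
    ∫⁻ u in Set.Ioc 0 M, ENNReal.ofReal (u ^ (-(3 / 4) : ℝ)) =
      ENNReal.ofReal (4 * M ^ (1 / 4 : ℝ)) := by
  have hi : IntervalIntegrable (fun u : ℝ => u ^ (-(3 / 4) : ℝ)) volume 0 M :=
    intervalIntegral.intervalIntegrable_rpow' (by norm_num)
  rw [← ofReal_integral_eq_lintegral_ofReal
    ((intervalIntegrable_iff_integrableOn_Ioc_of_le hM).1 hi)
    ((ae_restrict_iff' measurableSet_Ioc).2 (.of_forall fun u hu => Real.rpow_nonneg hu.1.le _)),
    ← intervalIntegral.integral_of_le hM, integral_rpow (Or.inl (by norm_num))]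
  congr 1
  rw [Real.zero_rpow (by norm_num)]
  norm_num
  ring

theorem lintegral_Ioi_rpow_neg_three_halves {R : ℝ} (hR : 0 < R) :
    ∫⁻ u in Set.Ioi R, ENNReal.ofReal (u ^ (-(3 / 2) : ℝ)) =
      ENNReal.ofReal (2 * R ^ (-(1 / 2) : ℝ)) := by
  rw [← ofReal_integral_eq_lintegral_ofReal
    (integrableOn_Ioi_rpow_of_lt (by norm_num) hR)
    ((ae_restrict_iff' measurableSet_Ioi).2
      (.of_forall fun u hu => Real.rpow_nonneg (hR.trans hu).le _)),
    integral_Ioi_rpow_of_lt (by norm_num) hR]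
  congr 1
  norm_num
  ring

theorem four_rpow_three_quarters_le : (4 : ℝ) ^ (3 / 4 : ℝ) ≤ 3 := by
  have h : (4 : ℝ) ^ (3 / 4 : ℝ) = ((4 : ℝ) ^ (3 : ℕ)) ^ ((4 : ℕ) : ℝ)⁻¹ := by
    rw [← Real.rpow_natCast, ← Real.rpow_mul (by norm_num)]
    norm_num
  rw [h, Real.rpow_inv_le_iff_of_pos (by norm_num) (by norm_num) (by norm_num)]
  norm_num

theorem turningPoint_kernel_le_of_far {t M : ℝ} (ht : 0 < t) (h : t / 2 ≤ |t - M|) :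
    (|t - M| / 2 * t) ^ (-(3 / 4) : ℝ) ≤ 3 * t ^ (-(3 / 2) : ℝ) := by
  calc (|t - M| / 2 * t) ^ (-(3 / 4) : ℝ) ≤ (t ^ 2 / 4) ^ (-(3 / 4) : ℝ) := by
        refine Real.rpow_le_rpow_of_nonpos (by positivity) ?_ (by norm_num)
        nlinarith
    _ = 4 ^ (3 / 4 : ℝ) * t ^ (-(3 / 2) : ℝ) := by
        rw [Real.div_rpow (by positivity) (by norm_num), Real.rpow_neg (x := 4) (by norm_num),
          ← Real.rpow_natCast, ← Real.rpow_mul ht.le, div_inv_eq_mul, mul_comm]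
        norm_num
    _ ≤ _ := by
        gcongr
        exact four_rpow_three_quarters_le

theorem turningPoint_kernel_le_of_near {t M : ℝ} (hM : 0 < M) (h : |t - M| < t / 2) :
    (|t - M| / 2 * t) ^ (-(3 / 4) : ℝ) ≤
      3 * M ^ (-(3 / 4) : ℝ) * |t - M| ^ (-(3 / 4) : ℝ) := by
  have ht : M / 2 ≤ t := by have := abs_lt.1 h; linarith
  -- At t = M both sides vanish, because `Real.rpow` sends base 0 with nonzero exponent to 0.
  rcases eq_or_ne t M with rfl | hne
  · simp only [sub_self, abs_zero, zero_div, zero_mul]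
    rw [Real.zero_rpow (by norm_num)]
    simp
  have hpos : 0 < |t - M| := abs_pos.2 (sub_ne_zero.2 hne)
  calc (|t - M| / 2 * t) ^ (-(3 / 4) : ℝ) ≤ (M / 4 * |t - M|) ^ (-(3 / 4) : ℝ) := by
        refine Real.rpow_le_rpow_of_nonpos (by positivity) ?_ (by norm_num)
        nlinarith
    _ = 4 ^ (3 / 4 : ℝ) * M ^ (-(3 / 4) : ℝ) * |t - M| ^ (-(3 / 4) : ℝ) := by
        rw [Real.mul_rpow (by positivity) hpos.le, Real.div_rpow hM.le (by norm_num),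
          Real.rpow_neg (x := 4) (by norm_num), div_inv_eq_mul]
        ring
    _ ≤ _ := by
        gcongr
        exact four_rpow_three_quarters_le

/-- The bound does not depend on M: away from the turning point the kernel is O(t^(-3/2)). The
singularity at M contributes O(M^(-1/2)) and matters only if 2M > R. The constant is 6 + 2 · 24. -/
theorem lintegral_turningPoint_kernel_le {M R : ℝ} (hM : 0 ≤ M) (hR : 0 < R) :
    ∫⁻ t in Set.Ioi R, ENNReal.ofReal ((|t - M| / 2 * t) ^ (-(3 / 4) : ℝ)) ≤
      ENNReal.ofReal (54 * R ^ (-(1 / 2) : ℝ)) := by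
  have hfar : ∫⁻ t in Set.Ioi R, ENNReal.ofReal (3 * t ^ (-(3 / 2) : ℝ)) =
      ENNReal.ofReal (6 * R ^ (-(1 / 2) : ℝ)) := by
    simp only [ENNReal.ofReal_mul (p := 3) (by norm_num)]
    rw [lintegral_const_mul _ (by fun_prop), lintegral_Ioi_rpow_neg_three_halves hR,
      ← ENNReal.ofReal_mul (by norm_num)]
    congr 1
    ring
  rcases le_or_gt (2 * M) R with hMR | hMR
  · refine (setLIntegral_mono (by fun_prop) fun t ht => ENNReal.ofReal_le_ofReal
      (turningPoint_kernel_le_of_far (hR.trans ht) ?_)).trans (hfar.trans_le ?_)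
    · rw [abs_of_nonneg] <;> linarith [Set.mem_Ioi.1 ht]
    · gcongr
      norm_num
  have hM0 : 0 < M := by linarith
  set H : ℝ → ℝ≥0∞ := (Set.Ioc 0 M).indicator fun u => ENNReal.ofReal (u ^ (-(3 / 4) : ℝ)) with hH
  have hHm : Measurable H := Measurable.indicator (by fun_prop) measurableSet_Ioc
  have hHi : ∫⁻ u, H u = ENNReal.ofReal (4 * M ^ (1 / 4 : ℝ)) := by
    rw [hH, lintegral_indicator measurableSet_Ioc, lintegral_Ioc_rpow_neg_three_quarters hM]
  set c : ℝ≥0∞ := ENNReal.ofReal (3 * M ^ (-(3 / 4) : ℝ)) with hc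
  have hpt : ∀ t ∈ Set.Ioi R, ENNReal.ofReal ((|t - M| / 2 * t) ^ (-(3 / 4) : ℝ)) ≤
      ENNReal.ofReal (3 * t ^ (-(3 / 2) : ℝ)) + c * (H (t - M) + H (M - t)) := by
    intro t ht
    rcases le_or_gt (t / 2) |t - M| with h | h
    · exact (ENNReal.ofReal_le_ofReal
        (turningPoint_kernel_le_of_far (hR.trans ht) h)).trans le_self_add
    · refine le_trans ?_ le_add_self
      have h2 := abs_lt.1 h
      rcases lt_trichotomy t M with hlt | rfl | hgt
      · refine (ENNReal.ofReal_le_ofReal (turningPoint_kernel_le_of_near hM0 h)).trans ?_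
        rw [ENNReal.ofReal_mul (by positivity), abs_of_neg (by linarith), neg_sub]
        gcongr
        refine le_trans (le_of_eq ?_) le_add_self
        rw [hH, Set.indicator_of_mem]
        exact ⟨by linarith, by linarith [hR.trans ht]⟩
      · simp [Real.zero_rpow]
      · refine (ENNReal.ofReal_le_ofReal (turningPoint_kernel_le_of_near hM0 h)).trans ?_
        rw [ENNReal.ofReal_mul (by positivity), abs_of_pos (by linarith)]
        gcongr
        refine le_trans (le_of_eq ?_) le_self_add
        rw [hH, Set.indicator_of_mem]
        exact ⟨by linarith, by linarith⟩
  have hnear : ∫⁻ t in Set.Ioi R, c * (H (t - M) + H (M - t)) ≤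
      ENNReal.ofReal (24 * M ^ (-(1 / 2) : ℝ)) := by
    refine (setLIntegral_le_lintegral _ _).trans ?_
    rw [lintegral_const_mul _ (by fun_prop), lintegral_add_left (by fun_prop),
      lintegral_sub_right_eq_self, lintegral_sub_left_eq_self, hHi,
      ← ENNReal.ofReal_add (by positivity) (by positivity), hc,
      ← ENNReal.ofReal_mul (by positivity)]
    refine ENNReal.ofReal_le_ofReal (le_of_eq ?_)
    have : M ^ (-(1 / 2) : ℝ) = M ^ (-(3 / 4) : ℝ) * M ^ (1 / 4 : ℝ) := by
      rw [← Real.rpow_add hM0]; norm_num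
    rw [this]
    ring
  refine (setLIntegral_mono (by fun_prop) hpt).trans ?_
  rw [lintegral_add_left (by fun_prop), hfar]
  refine (add_le_add_right hnear _).trans ?_
  rw [← ENNReal.ofReal_add (by positivity) (by positivity)]
  refine ENNReal.ofReal_le_ofReal ?_
  have h3 : M ^ (-(1 / 2) : ℝ) ≤ 2 * R ^ (-(1 / 2) : ℝ) := by
    calc M ^ (-(1 / 2) : ℝ) ≤ (R / 4) ^ (-(1 / 2) : ℝ) :=
          Real.rpow_le_rpow_of_nonpos (by positivity) (by linarith) (by norm_num)
      _ = 2 * R ^ (-(1 / 2) : ℝ) := by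
          rw [Real.div_rpow hR.le (by norm_num), Real.rpow_neg (x := 4) (by norm_num),
            ← Real.sqrt_eq_rpow, show (4 : ℝ) = 2 ^ 2 by norm_num, Real.sqrt_sq (by norm_num)]
          field_simp
  linarith

theorem norm_besselCoeff_cube_le {m : ℤ} {σ t : ℝ} (hσ : |σ| = 1) (ht : 0 < t)
    (hm : t ≠ |(m : ℝ)|) :
    ‖besselCoeff m (σ * t)‖ ^ 3 ≤ 343 * (|(t - |(m : ℝ)|)| / 2 * t) ^ (-(3 / 4) : ℝ) := by
  have hst : |σ * t| = t := by rw [abs_mul, hσ, one_mul, abs_of_pos ht]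
  have h := norm_besselCoeff_le (m := m) (t := σ * t) (by
    rw [← abs_pos, hst]; exact ht) (by rwa [hst])
  rw [hst] at h
  refine (pow_le_pow_left₀ (norm_nonneg _) h 3).trans (le_of_eq ?_)
  rw [mul_pow, ← Real.rpow_natCast (_ ^ _), ← Real.rpow_mul (by positivity)]
  norm_num

/-- AM-GM separates the three turning points, leaving one integrable singularity in each summand. -/
theorem prod_fin_three_le_sum_cube {x : Fin 3 → ℝ} (hx : ∀ i, 0 ≤ x i) :
    ∏ i, x i ≤ ∑ i, x i ^ 3 := by
  rw [Fin.prod_univ_three, Fin.sum_univ_three]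
  nlinarith [hx 0, hx 1, hx 2, mul_nonneg (hx 0) (sq_nonneg (x 0 - x 1)),
    mul_nonneg (hx 1) (sq_nonneg (x 0 - x 1)), mul_nonneg (hx 2) (sq_nonneg (x 0 - x 1)),
    mul_nonneg (hx 0) (sq_nonneg (x 1 - x 2)), mul_nonneg (hx 1) (sq_nonneg (x 1 - x 2)),
    mul_nonneg (hx 2) (sq_nonneg (x 1 - x 2)), mul_nonneg (hx 0) (sq_nonneg (x 0 - x 2)),
    mul_nonneg (hx 1) (sq_nonneg (x 0 - x 2)), mul_nonneg (hx 2) (sq_nonneg (x 0 - x 2)),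
    pow_nonneg (hx 0) 3, pow_nonneg (hx 1) 3, pow_nonneg (hx 2) 3]

/-- The absolute constant in the decay of the Fourier coefficients of the resolvent. -/
noncomputable def decayConst : ℝ := 222265

theorem lintegral_prod_besselCoeff_le {σ : ℝ} (hσ : |σ| = 1) (n : Fin 3 → ℤ) (j : Fin 3) :
    ∫⁻ t in Set.Ioi (0 : ℝ), ENNReal.ofReal (∏ i, ‖besselCoeff (n i) (σ * t)‖) ≤
      ENNReal.ofReal (decayConst * (1 + |(n j : ℝ)|) ^ (-(1 / 2) : ℝ)) := by
  set M := |(n j : ℝ)| with hM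
  have hM0 : 0 ≤ M := abs_nonneg _
  set R := (1 + M) / 16 with hR
  have hR0 : 0 < R := by positivity
  -- Here only the j-th factor is used; the other two are at most 1.
  have hsmall : ∫⁻ t in Set.Ioc 0 R, ENNReal.ofReal (∏ i, ‖besselCoeff (n i) (σ * t)‖) ≤
      ENNReal.ofReal ((1 + M) ^ (-(1 / 2) : ℝ)) := by
    have hb : ∀ t ∈ Set.Ioc 0 R, ENNReal.ofReal (∏ i, ‖besselCoeff (n i) (σ * t)‖) ≤
        ENNReal.ofReal (8 / (1 + M) ^ 2) := by
      intro t ht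
      refine ENNReal.ofReal_le_ofReal ?_
      rw [← Finset.mul_prod_erase _ _ (Finset.mem_univ j)]
      refine (mul_le_of_le_one_right (norm_nonneg _) (Finset.prod_le_one
        (fun _ _ => norm_nonneg _) fun _ _ => norm_besselCoeff_le_one _ _)).trans ?_
      refine norm_besselCoeff_le_of_small ?_
      rw [abs_mul, hσ, one_mul, abs_of_pos ht.1]
      exact ht.2
    refine (setLIntegral_mono measurable_const hb).trans ?_
    rw [setLIntegral_const, Real.volume_Ioc, sub_zero, ← ENNReal.ofReal_mul (by positivity)]
    refine ENNReal.ofReal_le_ofReal ?_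
    have h1 : 8 / (1 + M) ^ 2 * R ≤ (1 + M) ^ (-1 : ℝ) := by
      rw [hR, Real.rpow_neg_one]
      field_simp
      norm_num
    exact h1.trans (Real.rpow_le_rpow_of_exponent_le (by linarith) (by norm_num))
  -- 222264 = 3 · 343 · 54 · 4, the last factor coming from the 16 in R. The short times add 1,
  -- which gives `decayConst`.
  have hlarge : ∫⁻ t in Set.Ioi R, ENNReal.ofReal (∏ i, ‖besselCoeff (n i) (σ * t)‖) ≤
      ENNReal.ofReal (222264 * (1 + M) ^ (-(1 / 2) : ℝ)) := by
    have hae : ∀ᵐ t ∂volume.restrict (Set.Ioi R),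
        ENNReal.ofReal (∏ i, ‖besselCoeff (n i) (σ * t)‖) ≤
          ∑ i, ENNReal.ofReal 343 *
            ENNReal.ofReal ((|(t - |(n i : ℝ)|)| / 2 * t) ^ (-(3 / 4) : ℝ)) := by
      have h3 : ∀ᵐ t : ℝ ∂volume.restrict (Set.Ioi R), ∀ i, t ≠ |(n i : ℝ)| :=
        ae_all_iff.2 fun i => Measure.ae_ne _ _
      filter_upwards [h3, ae_restrict_mem measurableSet_Ioi] with t ht htR
      simp only [← ENNReal.ofReal_mul (p := 343) (by norm_num)]
      have ht0 : 0 < t := hR0.trans htR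
      rw [← ENNReal.ofReal_sum_of_nonneg fun i _ => by positivity]
      refine ENNReal.ofReal_le_ofReal ((prod_fin_three_le_sum_cube
        fun _ => norm_nonneg _).trans (Finset.sum_le_sum fun i _ => ?_))
      exact norm_besselCoeff_cube_le hσ ht0 (ht i)
    refine (lintegral_mono_ae hae).trans ?_
    rw [lintegral_finsetSum _ fun i _ => by fun_prop]
    have hR2 : R ^ (-(1 / 2) : ℝ) = 4 * (1 + M) ^ (-(1 / 2) : ℝ) := by
      rw [hR, Real.div_rpow (by positivity) (by norm_num), Real.rpow_neg (x := 16) (by norm_num),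
        ← Real.sqrt_eq_rpow, show (16 : ℝ) = 4 ^ 2 by norm_num, Real.sqrt_sq (by norm_num)]
      field_simp
    calc _ ≤ ∑ _i : Fin 3, ENNReal.ofReal 343 * ENNReal.ofReal (54 * R ^ (-(1 / 2) : ℝ)) := by
          refine Finset.sum_le_sum fun i _ => ?_
          rw [lintegral_const_mul _ (by fun_prop)]
          gcongr
          exact lintegral_turningPoint_kernel_le (abs_nonneg _) hR0
      _ ≤ _ := by
          rw [← ENNReal.ofReal_mul (by norm_num),
            ← ENNReal.ofReal_sum_of_nonneg fun i _ => by positivity, hR2]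
          refine ENNReal.ofReal_le_ofReal (le_of_eq ?_)
          simp only [Finset.sum_const, Finset.card_univ, Fintype.card_fin, nsmul_eq_mul]
          push_cast
          ring
  rw [← Set.Ioc_union_Ioi_eq_Ioi hR0.le]
  refine (lintegral_union_le _ _ _).trans ((add_le_add hsmall hlarge).trans ?_)
  rw [← ENNReal.ofReal_add (by positivity) (by positivity)]
  refine ENNReal.ofReal_le_ofReal (le_of_eq ?_)
  rw [decayConst]
  ring

/-! ### Fourier coefficients of the resolvent on the torus -/

theorem volume_unitAddCircle_eq :
    (volume : Measure UnitAddCircle) = AddCircle.haarAddCircle := by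
  rw [AddCircle.volume_eq_smul_haarAddCircle, ENNReal.ofReal_one, one_smul]

theorem volume_torus_eq :
    (volume : Measure Torus3) = Measure.pi fun _ => AddCircle.haarAddCircle := by
  rw [volume_pi]
  simp only [volume_unitAddCircle_eq]

theorem continuous_kineticEnergy : Continuous kineticEnergy := by
  have := continuous_cosTwoPi
  unfold kineticEnergy
  fun_prop

theorem kineticEnergy_neg (k : Torus3) : kineticEnergy (-k) = kineticEnergy k := by
  simp only [kineticEnergy, Pi.neg_apply, cosTwoPi_neg]

theorem kineticEnergy_mem_Icc (k : Torus3) : kineticEnergy k ∈ Set.Icc (0 : ℝ) 6 := by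
  have h := fun i => abs_le.1 (abs_cosTwoPi_le_one (k i))
  rw [kineticEnergy, Fin.sum_univ_three]
  constructor <;> linarith [(h 0).1, (h 0).2, (h 1).1, (h 1).2, (h 2).1, (h 2).2]

/-- The Fourier coefficients of a function on the torus, with respect to `volume`. -/
noncomputable def torusCoeff (f : Torus3 → ℂ) (n : Fin 3 → ℤ) : ℂ :=
  ∫ k : Torus3, mFourier (-n) k * f k

theorem norm_mFourier_apply (n : Fin 3 → ℤ) (k : Torus3) : ‖mFourier n k‖ = 1 := by
  rw [mFourier, ContinuousMap.coe_mk, norm_prod]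
  exact Finset.prod_eq_one fun i _ => norm_fourier_apply _ _

theorem integrable_of_continuous {f : Torus3 → ℂ} (hf : Continuous f) : Integrable f :=
  hf.integrable_of_hasCompactSupport (.of_compactSpace _)

/-- The kinetic energy is a sum over coordinates, so the free propagator factorises. -/
theorem integral_mFourier_mul_exp_kineticEnergy (n : Fin 3 → ℤ) (t : ℝ) :
    ∫ k : Torus3, mFourier (-n) k * Complex.exp ((-(t * kineticEnergy k) : ℝ) * Complex.I) =
      Complex.exp ((-(3 * t) : ℝ) * Complex.I) * ∏ i, besselCoeff (n i) t := by
  simp only [besselCoeff_eq_integral, ← volume_unitAddCircle_eq]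
  rw [← integral_fintype_prod_volume_eq_prod (fun (i : Fin 3) (x : UnitAddCircle) =>
    fourier (-n i) x * Complex.exp ((t * cosTwoPi x : ℝ) * Complex.I)), ← integral_const_mul]
  refine integral_congr_ae (.of_forall fun k => ?_)
  simp only [mFourier, ContinuousMap.coe_mk, kineticEnergy, Finset.prod_mul_distrib, Pi.neg_apply,
    ← Complex.exp_sum]
  rw [mul_left_comm, ← Complex.exp_add]
  congr 2
  simp only [Fin.sum_univ_three]
  push_cast
  ring

theorem inv_eq_integral_exp {z : ℂ} (hz : 0 < z.re) :
    z⁻¹ = ∫ t in Set.Ioi (0 : ℝ), Complex.exp (-z * t) := by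
  rw [integral_exp_mul_complex_Ioi (by simpa using hz)]
  simp [neg_div_neg_eq]

/-- Decay of the Fourier coefficients of the resolvent, uniformly in the spectral parameter. -/
theorem norm_torusCoeff_resolvent_le {δ : ℝ} (hδ : 0 < δ) (a : ℝ) {σ : ℝ} (hσ : |σ| = 1)
    (n : Fin 3 → ℤ) (j : Fin 3) :
    ‖torusCoeff (fun k => ((δ : ℂ) + (σ * (kineticEnergy k - a) : ℝ) * Complex.I)⁻¹) n‖ ≤
      decayConst * (1 + |(n j : ℝ)|) ^ (-(1 / 2) : ℝ) := by
  have hce := continuous_kineticEnergy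
  have hD : 0 ≤ decayConst * (1 + |(n j : ℝ)|) ^ (-(1 / 2) : ℝ) := by
    rw [decayConst]; positivity
  set F : Torus3 → ℝ → ℂ := fun k t => mFourier (-n) k *
    Complex.exp (-((δ : ℂ) + (σ * (kineticEnergy k - a) : ℝ) * Complex.I) * t) with hF
  have hnF : ∀ k t, ‖F k t‖ = Real.exp (-δ * t) := by
    intro k t
    rw [hF]
    simp only [norm_mul, norm_mFourier_apply, one_mul, Complex.norm_exp]
    congr 1
    simp
  have h1 : torusCoeff (fun k => ((δ : ℂ) + (σ * (kineticEnergy k - a) : ℝ) * Complex.I)⁻¹) n =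
      ∫ k, ∫ t in Set.Ioi (0 : ℝ), F k t := by
    refine integral_congr_ae (.of_forall fun k => ?_)
    simp only [hF]
    rw [integral_const_mul, ← inv_eq_integral_exp (by simpa using hδ)]
  have hint : Integrable (Function.uncurry F)
      (volume.prod (volume.restrict (Set.Ioi (0 : ℝ)))) := by
    have hg : Integrable (fun t : ℝ => Real.exp (-δ * t)) (volume.restrict (Set.Ioi (0 : ℝ))) :=
      integrableOn_exp_mul_Ioi (neg_lt_zero.2 hδ) 0
    refine (hg.comp_snd (volume : Measure Torus3)).mono' ?_
      (.of_forall fun x => (hnF x.1 x.2).le)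
    refine Continuous.aestronglyMeasurable ?_
    simp only [Function.uncurry_def, hF]
    fun_prop
  rw [h1, integral_integral_swap hint]
  -- Discarding exp(-δ t) ≤ 1, and the phase carrying a, makes the bound uniform in δ and a.
  have h2 : ∀ t ∈ Set.Ioi (0 : ℝ), ‖∫ k, F k t‖ ≤ ∏ i, ‖besselCoeff (n i) (σ * t)‖ := by
    intro t ht
    have h3 : ∀ k, F k t = Complex.exp (-(δ * t) + (σ * a * t : ℝ) * Complex.I) *
        (mFourier (-n) k * Complex.exp ((-(σ * t * kineticEnergy k) : ℝ) * Complex.I)) := by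
      intro k
      rw [hF, mul_left_comm, ← Complex.exp_add]
      simp only
      congr 2
      push_cast
      ring
    simp only [h3]
    rw [integral_const_mul, integral_mFourier_mul_exp_kineticEnergy, norm_mul, norm_mul,
      Complex.norm_exp_ofReal_mul_I, one_mul, norm_prod]
    refine mul_le_of_le_one_left (by positivity) ?_
    rw [Complex.norm_exp, Real.exp_le_one_iff]
    simpa using (mul_pos hδ (Set.mem_Ioi.1 ht)).le
  rw [← ENNReal.ofReal_le_ofReal_iff hD, ofReal_norm]
  refine (enorm_integral_le_lintegral_enorm _).trans
    (le_trans ?_ (lintegral_prod_besselCoeff_le hσ n j))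
  refine setLIntegral_mono' measurableSet_Ioi fun t ht => ?_
  rw [← ofReal_norm]
  exact ENNReal.ofReal_le_ofReal (h2 t ht)

/-! ### Lorentzians and the dyadic majorant -/

/-- The real part of 1 / (δ + i x): nonnegative for δ ≥ 0, hence usable as a majorant, yet a
combination of resolvents whose coefficients are controlled. -/
noncomputable def lorentzian (δ x : ℝ) : ℝ := δ / (δ ^ 2 + x ^ 2)

theorem continuous_lorentzian {δ : ℝ} (hδ : 0 < δ) : Continuous (lorentzian δ) :=
  continuous_const.div (by fun_prop) fun x => by positivity

theorem lorentzian_nonneg {δ : ℝ} (hδ : 0 ≤ δ) (x : ℝ) : 0 ≤ lorentzian δ x := by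
  unfold lorentzian; positivity

theorem lorentzian_le {δ : ℝ} (hδ : 0 < δ) (x : ℝ) : lorentzian δ x ≤ δ⁻¹ := by
  unfold lorentzian
  rw [div_le_iff₀ (by positivity), ← div_eq_inv_mul, le_div_iff₀ hδ]
  nlinarith [sq_nonneg x]

theorem lorentzian_eq_inv_add_inv {δ : ℝ} (hδ : 0 < δ) (x : ℝ) :
    (lorentzian δ x : ℂ) = 1 / 2 * (((δ : ℂ) + ((1 : ℝ) * x : ℝ) * Complex.I)⁻¹ +
      ((δ : ℂ) + ((-1 : ℝ) * x : ℝ) * Complex.I)⁻¹) := by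
  have h0 : (δ : ℂ) ^ 2 + (x : ℂ) ^ 2 ≠ 0 := by
    have : δ ^ 2 + x ^ 2 ≠ 0 := by positivity
    exact_mod_cast this
  have h1 : (δ : ℂ) + x * Complex.I ≠ 0 := by
    intro h; have := congrArg Complex.re h; simp at this; exact hδ.ne' this
  have h2 : (δ : ℂ) - x * Complex.I ≠ 0 := by
    intro h; have := congrArg Complex.re h; simp at this; exact hδ.ne' this
  have h3 : ((δ : ℂ) + x * Complex.I) * ((δ : ℂ) - x * Complex.I) = (δ : ℂ) ^ 2 + (x : ℂ) ^ 2 := by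
    linear_combination (-(x : ℂ) ^ 2) * Complex.I_sq
  unfold lorentzian
  push_cast
  simp only [one_mul, neg_mul, ← sub_eq_add_neg]
  rw [inv_add_inv h1 h2, h3]
  field_simp
  ring

theorem norm_torusCoeff_lorentzian_le {δ : ℝ} (hδ : 0 < δ) (a : ℝ) (n : Fin 3 → ℤ) (j : Fin 3) :
    ‖torusCoeff (fun k => (lorentzian δ (kineticEnergy k - a) : ℂ)) n‖ ≤
      decayConst * (1 + |(n j : ℝ)|) ^ (-(1 / 2) : ℝ) := by
  have hce := continuous_kineticEnergy
  have hc : ∀ σ : ℝ, Continuous fun k : Torus3 =>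
      ((δ : ℂ) + (σ * (kineticEnergy k - a) : ℝ) * Complex.I)⁻¹ := fun σ => by
    refine Continuous.inv₀ (by fun_prop) fun k h => ?_
    have := congrArg Complex.re h
    simp at this
    exact hδ.ne' this
  have h : torusCoeff (fun k => (lorentzian δ (kineticEnergy k - a) : ℂ)) n = 1 / 2 *
      (torusCoeff (fun k => ((δ : ℂ) + ((1 : ℝ) * (kineticEnergy k - a) : ℝ) * Complex.I)⁻¹) n +
       torusCoeff (fun k => ((δ : ℂ) + ((-1 : ℝ) * (kineticEnergy k - a) : ℝ) * Complex.I)⁻¹) n) := by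
    have c1 := hc 1
    have c2 := hc (-1)
    simp only [torusCoeff]
    rw [← integral_add (integrable_of_continuous (by fun_prop))
      (integrable_of_continuous (by fun_prop)), ← integral_const_mul]
    refine integral_congr_ae (.of_forall fun k => ?_)
    simp only [lorentzian_eq_inv_add_inv hδ]
    ring
  rw [h, norm_mul]
  have h1 := norm_torusCoeff_resolvent_le hδ a (σ := 1) (by simp) n j
  have h2 := norm_torusCoeff_resolvent_le hδ a (σ := -1) (by simp) n j
  have h3 := norm_add_le
    (torusCoeff (fun k => ((δ : ℂ) + ((1 : ℝ) * (kineticEnergy k - a) : ℝ) * Complex.I)⁻¹) n)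
    (torusCoeff (fun k => ((δ : ℂ) + ((-1 : ℝ) * (kineticEnergy k - a) : ℝ) * Complex.I)⁻¹) n)
  norm_num at h1 h2 h3 ⊢
  linarith

/-- A sum of Lorentzians over the dyadic scales `2 ^ l ε`, `l < J`, centred at the level `a`. -/
noncomputable def dyadicMajorant (ε : ℝ) (J : ℕ) (a : ℝ) (k : Torus3) : ℝ :=
  ∑ l ∈ Finset.range J, lorentzian (2 ^ l * ε) (kineticEnergy k - a)

theorem continuous_dyadicMajorant {ε : ℝ} (hε : 0 < ε) (J : ℕ) (a : ℝ) :
    Continuous (dyadicMajorant ε J a) :=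
  continuous_finsetSum _ fun l _ => (continuous_lorentzian (by positivity)).comp
    (continuous_kineticEnergy.sub continuous_const)

theorem dyadicMajorant_nonneg {ε : ℝ} (hε : 0 < ε) (J : ℕ) (a : ℝ) (k : Torus3) :
    0 ≤ dyadicMajorant ε J a k :=
  Finset.sum_nonneg fun _ _ => lorentzian_nonneg (by positivity) _

theorem dyadicMajorant_neg (ε : ℝ) (J : ℕ) (a : ℝ) (k : Torus3) :
    dyadicMajorant ε J a (-k) = dyadicMajorant ε J a k := by
  simp only [dyadicMajorant, kineticEnergy_neg]

theorem dyadicMajorant_le {ε : ℝ} (hε : 0 < ε) (J : ℕ) (a : ℝ) (k : Torus3) :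
    dyadicMajorant ε J a k ≤ 2 / ε := by
  have h : ∀ J : ℕ, ∑ l ∈ Finset.range J, (2 ^ l * ε)⁻¹ = (2 - 2 * (1 / 2) ^ J) / ε := by
    intro J
    induction J with
    | zero => simp
    | succ J ih =>
      rw [Finset.sum_range_succ, ih, pow_succ]
      have : (1 / 2 : ℝ) ^ J = (2 ^ J)⁻¹ := by rw [one_div, inv_pow]
      rw [this]
      field_simp
      ring
  refine (Finset.sum_le_sum fun l _ => lorentzian_le (by positivity) _).trans ?_
  rw [h]
  gcongr
  have : (0 : ℝ) ≤ (1 / 2) ^ J := by positivity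
  linarith

theorem norm_torusCoeff_dyadicMajorant_le {ε : ℝ} (hε : 0 < ε) (J : ℕ) (a : ℝ) (n : Fin 3 → ℤ)
    (j : Fin 3) :
    ‖torusCoeff (fun k => (dyadicMajorant ε J a k : ℂ)) n‖ ≤
      J * decayConst * (1 + |(n j : ℝ)|) ^ (-(1 / 2) : ℝ) := by
  have h : torusCoeff (fun k => (dyadicMajorant ε J a k : ℂ)) n = ∑ l ∈ Finset.range J,
      torusCoeff (fun k => (lorentzian (2 ^ l * ε) (kineticEnergy k - a) : ℂ)) n := by
    simp only [torusCoeff]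
    rw [← integral_finsetSum _ fun l _ => integrable_of_continuous ?_]
    · simp only [dyadicMajorant, Complex.ofReal_sum, Finset.mul_sum]
    · have := continuous_lorentzian (δ := 2 ^ l * ε) (by positivity)
      have := continuous_kineticEnergy
      fun_prop
  rw [h]
  refine (norm_sum_le _ _).trans ((Finset.sum_le_sum fun l _ =>
    norm_torusCoeff_lorentzian_le (by positivity) a n j).trans_eq ?_)
  rw [Finset.sum_const, Finset.card_range, nsmul_eq_mul, mul_assoc]

/-- Supremum times mean: the scales sum geometrically to at most 2 / ε, and the mean is the zeroth
Fourier coefficient. -/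
theorem integral_dyadicMajorant_sq_le {ε : ℝ} (hε : 0 < ε) (J : ℕ) (a : ℝ) :
    ∫ k, dyadicMajorant ε J a k ^ 2 ≤ 2 / ε * (J * decayConst) := by
  have hc := continuous_dyadicMajorant hε J a
  have hi : Integrable (dyadicMajorant ε J a) :=
    hc.integrable_of_hasCompactSupport (.of_compactSpace _)
  have h0 := norm_torusCoeff_dyadicMajorant_le hε J a 0 0
  have h1 : torusCoeff (fun k => (dyadicMajorant ε J a k : ℂ)) 0 =
      ((∫ k, dyadicMajorant ε J a k : ℝ) : ℂ) := by
    rw [torusCoeff, ← integral_complex_ofReal]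
    simp [mFourier_zero]
  rw [h1, Complex.norm_real] at h0
  have h2 : ∫ k, dyadicMajorant ε J a k ≤ J * decayConst := by
    refine (Real.le_norm_self _).trans (h0.trans_eq ?_)
    simp
  calc ∫ k, dyadicMajorant ε J a k ^ 2 ≤ ∫ k, 2 / ε * dyadicMajorant ε J a k := by
        refine integral_mono ((hc.pow 2).integrable_of_hasCompactSupport (.of_compactSpace _))
          (hi.const_mul _) fun k => ?_
        simp only [sq]
        exact mul_le_mul_of_nonneg_right (dyadicMajorant_le hε J a k)
          (dyadicMajorant_nonneg hε J a k)
    _ ≤ _ := by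
        rw [integral_const_mul]
        gcongr

/-! ### Parseval and the double convolution -/

/-- The measure is written out because the proof locally makes `haarAddCircle` the volume of the
circle; `volume_torus_eq` then carries the identity back. -/
theorem hasSum_conj_mul_pi_haar (f g : C(Torus3, ℂ)) :
    HasSum (fun n : Fin 3 → ℤ =>
        conj (∫ k, mFourier (-n) k * f k ∂(Measure.pi fun _ => AddCircle.haarAddCircle)) *
          ∫ k, mFourier (-n) k * g k ∂(Measure.pi fun _ => AddCircle.haarAddCircle))
      (∫ k, conj (f k) * g k ∂(Measure.pi fun _ => AddCircle.haarAddCircle)) := by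
  let _ : MeasureSpace UnitAddCircle := ⟨AddCircle.haarAddCircle⟩
  have : IsProbabilityMeasure (volume : Measure UnitAddCircle) :=
    inferInstanceAs (IsProbabilityMeasure AddCircle.haarAddCircle)
  have h := hasSum_prod_mFourierCoeff (d := Fin 3) (f.toLp 2 volume ℂ) (g.toLp 2 volume ℂ)
  simp only [mFourierCoeff_toLp] at h
  have h2 : ∫ t, conj (f.toLp 2 volume ℂ t) * (g.toLp 2 volume ℂ t) =
      ∫ k, conj (f k) * g k := by
    refine integral_congr_ae ?_
    filter_upwards [f.coeFn_toLp (p := 2) (𝕜 := ℂ) volume,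
      g.coeFn_toLp (p := 2) (𝕜 := ℂ) volume] with t h1 h2
    rw [h1, h2]
  rw [h2] at h
  exact h

theorem hasSum_conj_torusCoeff_mul {f g : Torus3 → ℂ} (hf : Continuous f) (hg : Continuous g) :
    HasSum (fun n => conj (torusCoeff f n) * torusCoeff g n) (∫ k, conj (f k) * g k) := by
  simp only [torusCoeff, volume_torus_eq]
  exact hasSum_conj_mul_pi_haar ⟨f, hf⟩ ⟨g, hg⟩

theorem hasSum_norm_sq_torusCoeff {f : Torus3 → ℂ} (hf : Continuous f) :
    HasSum (fun n => ‖torusCoeff f n‖ ^ 2) (∫ k, ‖f k‖ ^ 2) := by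
  have h := hasSum_conj_torusCoeff_mul hf hf
  simp only [Complex.conj_mul', ← Complex.ofReal_pow] at h
  rw [integral_complex_ofReal] at h
  exact Complex.hasSum_ofReal.1 h

theorem mFourier_apply_add (n : Fin 3 → ℤ) (x y : Torus3) :
    mFourier n (x + y) = mFourier n x * mFourier n y := by
  simp only [mFourier, ContinuousMap.coe_mk, ← Finset.prod_mul_distrib, Pi.add_apply]
  refine Finset.prod_congr rfl fun i _ => ?_
  rw [fourier_apply, fourier_apply, fourier_apply, smul_add, AddCircle.toCircle_add, Circle.coe_mul]

theorem mFourier_neg_mul_self (n : Fin 3 → ℤ) (x : Torus3) :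
    mFourier (-n) x * mFourier n x = 1 := by
  rw [← mFourier_add, neg_add_cancel, mFourier_zero, ContinuousMap.one_apply]

theorem torusCoeff_translate (f : Torus3 → ℂ) (v : Torus3) (n : Fin 3 → ℤ) :
    torusCoeff (fun q => f (v + q)) n = mFourier n v * torusCoeff f n := by
  rw [torusCoeff, torusCoeff, ← integral_add_left_eq_self (fun k => mFourier (-n) k * f k) v,
    ← integral_const_mul]
  refine integral_congr_ae (.of_forall fun q => ?_)
  simp only [mFourier_apply_add]
  linear_combination (-(mFourier (-n) q * f (v + q))) * mFourier_neg_mul_self n v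

theorem integral_mFourier_mul (f : Torus3 → ℂ) (n : Fin 3 → ℤ) :
    ∫ k, f k * mFourier n k = torusCoeff f (-n) := by
  simp only [torusCoeff, neg_neg, mul_comm]

/-- Parseval expands the inner integral in characters of p + w, and integrating against f picks out
its coefficient at -n. The products of the coefficients of g and h are absolutely summable, which
permits the interchange; the character at w has modulus 1. -/
theorem abs_integral_triple_le_tsum {f g h : Torus3 → ℝ} (hf : Continuous f) (hg : Continuous g)
    (hh : Continuous h) (w : Torus3) :
    |∫ p, f p * ∫ q, g q * h (p + q + w)| ≤
      ∑' n, ‖torusCoeff (fun k => (f k : ℂ)) (-n)‖ * (‖torusCoeff (fun k => (g k : ℂ)) n‖ *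
        ‖torusCoeff (fun k => (h k : ℂ)) n‖) := by
  have cg : Continuous fun k => (g k : ℂ) := by fun_prop
  have ch : Continuous fun k => (h k : ℂ) := by fun_prop
  set A := torusCoeff (fun k => (f k : ℂ)) with hA
  set B := torusCoeff (fun k => (g k : ℂ)) with hB
  set C := torusCoeff (fun k => (h k : ℂ)) with hC
  have hsum : Summable fun n => ‖B n‖ * ‖C n‖ := by
    refine Summable.of_nonneg_of_le (fun n => by positivity) (fun n => ?_)
      ((hasSum_norm_sq_torusCoeff cg).summable.add (hasSum_norm_sq_torusCoeff ch).summable)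
    nlinarith [sq_nonneg (‖B n‖ - ‖C n‖), sq_nonneg ‖B n‖, sq_nonneg ‖C n‖]
  have hinner : ∀ p, ((∫ q, g q * h (p + q + w) : ℝ) : ℂ) =
      ∑' n, conj (B n) * (mFourier n (p + w) * C n) := by
    intro p
    have h1 := hasSum_conj_torusCoeff_mul cg
      (g := fun q => (h ((p + w) + q) : ℂ)) (by fun_prop)
    simp only [torusCoeff_translate (fun k => (h k : ℂ)) (p + w)] at h1
    rw [h1.tsum_eq, ← integral_complex_ofReal]
    refine integral_congr_ae (.of_forall fun q => ?_)
    simp only [Complex.conj_ofReal]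
    rw [add_right_comm]
    push_cast
    rfl
  set F : (Fin 3 → ℤ) → Torus3 → ℂ := fun n p =>
    conj (B n) * C n * mFourier n w * (f p * mFourier n p) with hF
  have hnF : ∀ n p, ‖F n p‖ = ‖B n‖ * ‖C n‖ * |f p| := by
    intro n p
    simp only [hF, norm_mul, norm_mFourier_apply, mul_one, RCLike.norm_conj, Complex.norm_real,
      Real.norm_eq_abs]
  have hFi : ∀ n, Integrable (F n) := fun n => integrable_of_continuous (by fun_prop)
  have hFs : Summable fun n => ∫ p, ‖F n p‖ := by
    simp only [hnF, integral_const_mul]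
    exact hsum.mul_right _
  have hswap := hasSum_integral_of_summable_integral_norm hFi hFs
  have hT : ((∫ p, f p * ∫ q, g q * h (p + q + w) : ℝ) : ℂ) = ∫ p, ∑' n, F n p := by
    rw [← integral_complex_ofReal]
    refine integral_congr_ae (.of_forall fun p => ?_)
    simp only
    rw [Complex.ofReal_mul, hinner, ← tsum_mul_left]
    refine tsum_congr fun n => ?_
    simp only [hF, mFourier_apply_add]
    ring
  have hFint : ∀ n, ‖∫ p, F n p‖ = ‖A (-n)‖ * (‖B n‖ * ‖C n‖) := by
    intro n
    simp only [hF]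
    rw [integral_const_mul, integral_mFourier_mul (fun k => (f k : ℂ)), norm_mul, norm_mul,
      norm_mul, norm_mFourier_apply, RCLike.norm_conj, mul_one, mul_comm]
  have hs : Summable fun n => ‖∫ p, F n p‖ :=
    Summable.of_nonneg_of_le (fun n => norm_nonneg _) (fun n => norm_integral_le_integral_norm _) hFs
  rw [← Real.norm_eq_abs, ← Complex.norm_real, hT, ← hswap.tsum_eq]
  refine (norm_tsum_le_tsum_norm hs).trans_eq (tsum_congr hFint)

/-! ### Splitting the frequency sum -/

theorem sum_Icc_one_add_abs_rpow_le (N : ℕ) :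
    ∑ m ∈ Finset.Icc (-(N : ℤ)) N, (1 + |(m : ℝ)|) ^ (-(1 / 2) : ℝ) ≤
      4 * ((N : ℝ) + 1) ^ (1 / 2 : ℝ) := by
  induction N with
  | zero => simp
  | succ N ih =>
    have hI : Finset.Icc (-((N + 1 : ℕ) : ℤ)) ((N + 1 : ℕ) : ℤ) =
        insert (-((N : ℤ) + 1)) (insert ((N : ℤ) + 1) (Finset.Icc (-(N : ℤ)) N)) := by
      ext m
      simp only [Finset.mem_Icc, Finset.mem_insert]
      push_cast
      omega
    rw [hI, Finset.sum_insert (by simp; omega), Finset.sum_insert (by simp)]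
    have h0 : (0 : ℝ) ≤ N := Nat.cast_nonneg N
    have habs : |(N : ℝ) + 1| = N + 1 := abs_of_nonneg (by linarith)
    push_cast
    rw [abs_neg, habs, Real.rpow_neg (by positivity), ← Real.sqrt_eq_rpow, ← Real.sqrt_eq_rpow]
    rw [← Real.sqrt_eq_rpow] at ih
    have e : (1 : ℝ) + (N + 1) = N + 1 + 1 := by ring
    rw [e]
    set u := √((N : ℝ) + 1) with hu
    set v := √((N : ℝ) + 1 + 1) with hv
    have hu2 : u ^ 2 = N + 1 := Real.sq_sqrt (by positivity)
    have hv2 : v ^ 2 = N + 1 + 1 := Real.sq_sqrt (by positivity)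
    have hv0 : 0 < v := Real.sqrt_pos.2 (by positivity)
    have hu0 : 0 ≤ u := Real.sqrt_nonneg _
    have huv : u ≤ v := Real.sqrt_le_sqrt (by linarith)
    -- From 1 = v² - u² = (v - u)(v + u) ≤ 2 v (v - u).
    have : v⁻¹ ≤ 2 * (v - u) := by
      rw [inv_le_iff_one_le_mul₀ hv0]
      nlinarith
    linarith

/-- Splitting a sum over `ℤ³` at frequency `N`: power decay at low frequencies, square summability
at high ones. -/
theorem tsum_triple_le {x y z : (Fin 3 → ℤ) → ℝ} {D S : ℝ} (hD : 0 ≤ D)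
    (hx0 : ∀ n, 0 ≤ x n) (hy0 : ∀ n, 0 ≤ y n) (hz0 : ∀ n, 0 ≤ z n)
    (hx : ∀ n j, x n ≤ D * (1 + |(n j : ℝ)|) ^ (-(1 / 2) : ℝ))
    (hy : ∀ n j, y n ≤ D * (1 + |(n j : ℝ)|) ^ (-(1 / 2) : ℝ))
    (hz : ∀ n j, z n ≤ D * (1 + |(n j : ℝ)|) ^ (-(1 / 2) : ℝ))
    (hys : Summable fun n => y n ^ 2) (hzs : Summable fun n => z n ^ 2)
    (hyS : ∑' n, y n ^ 2 ≤ S) (hzS : ∑' n, z n ^ 2 ≤ S) (N : ℕ) :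
    ∑' n, x n * (y n * z n) ≤ D ^ 3 * (4 * ((N : ℝ) + 1) ^ (1 / 2 : ℝ)) ^ 3 +
      D * ((N : ℝ) + 1) ^ (-(1 / 2) : ℝ) * S := by
  classical
  set box : Finset (Fin 3 → ℤ) := Fintype.piFinset fun _ => Finset.Icc (-(N : ℤ)) N with hbox
  set r : ℤ → ℝ := fun m => (1 + |(m : ℝ)|) ^ (-(1 / 2) : ℝ) with hr
  have hr0 : ∀ m, 0 ≤ r m := fun m => by positivity
  set low : (Fin 3 → ℤ) → ℝ := fun n => if n ∈ box then D ^ 3 * ∏ j, r (n j) else 0 with hlow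
  have hlow0 : ∀ n, 0 ≤ low n := fun n => by
    simp only [hlow]; split_ifs
    · exact mul_nonneg (by positivity) (Finset.prod_nonneg fun j _ => hr0 _)
    · exact le_rfl
  set c := D * ((N : ℝ) + 1) ^ (-(1 / 2) : ℝ) with hc
  have hc0 : 0 ≤ c := by positivity
  have hpt : ∀ n, x n * (y n * z n) ≤ low n + c / 2 * (y n ^ 2 + z n ^ 2) := by
    intro n
    by_cases hn : n ∈ box
    · have : x n * (y n * z n) ≤ D ^ 3 * ∏ j, r (n j) := by
        rw [Fin.prod_univ_three]
        calc x n * (y n * z n) ≤ (D * r (n 0)) * ((D * r (n 1)) * (D * r (n 2))) :=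
              mul_le_mul (hx n 0) (mul_le_mul (hy n 1) (hz n 2) (hz0 n)
                (mul_nonneg hD (hr0 _))) (mul_nonneg (hy0 n) (hz0 n)) (mul_nonneg hD (hr0 _))
          _ = _ := by ring
      simp only [hlow, if_pos hn]
      have : 0 ≤ c / 2 * (y n ^ 2 + z n ^ 2) := by positivity
      linarith
    · have hxc : x n ≤ c := by
        simp only [hbox, Fintype.mem_piFinset, Finset.mem_Icc, not_forall] at hn
        obtain ⟨j, hj⟩ := hn
        refine (hx n j).trans (mul_le_mul_of_nonneg_left ?_ hD)
        refine Real.rpow_le_rpow_of_nonpos (by positivity) ?_ (by norm_num)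
        have : (N : ℤ) ≤ |n j| := by
          by_contra hlt
          have := abs_le.1 (not_le.1 hlt).le
          exact hj this
        have : (N : ℝ) ≤ |(n j : ℝ)| := by exact_mod_cast this
        linarith
      have h1 : x n * (y n * z n) ≤ c * (y n * z n) :=
        mul_le_mul_of_nonneg_right hxc (mul_nonneg (hy0 n) (hz0 n))
      have h2 := mul_nonneg hc0 (sq_nonneg (y n - z n))
      have h3 := hlow0 n
      nlinarith
  have hlows : HasSum low (∑ n ∈ box, low n) :=
    hasSum_sum_of_ne_finset_zero fun n hn => by simp only [hlow, if_neg hn]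
  have hR := hlows.add ((hys.hasSum.add hzs.hasSum).mul_left (c / 2))
  have hle := (Summable.of_nonneg_of_le (fun n => mul_nonneg (hx0 n)
    (mul_nonneg (hy0 n) (hz0 n))) hpt hR.summable).tsum_le_tsum hpt hR.summable
  rw [hR.tsum_eq] at hle
  refine hle.trans (add_le_add ?_ ?_)
  · rw [Finset.sum_congr rfl fun n hn => (if_pos hn : low n = D ^ 3 * ∏ j, r (n j)),
      ← Finset.mul_sum, hbox, ← Finset.prod_univ_sum (fun _ : Fin 3 => Finset.Icc (-(N : ℤ)) N)
        fun _ m => r m, Finset.prod_const, Finset.card_univ, Fintype.card_fin]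
    refine mul_le_mul_of_nonneg_left (pow_le_pow_left₀ (Finset.sum_nonneg fun m _ => hr0 m)
      (sum_Icc_one_add_abs_rpow_le N) 3) (by positivity)
  · nlinarith

theorem integral_triple_dyadicMajorant_le {ε : ℝ} (hε : 0 < ε) (hε1 : ε ≤ 1) {J : ℕ} (hJ : 1 ≤ J)
    (a b c : ℝ) (w : Torus3) :
    ∫ p, dyadicMajorant ε J a p * ∫ q, dyadicMajorant ε J b q * dyadicMajorant ε J c (p + q + w) ≤
      1000 * (J * decayConst) ^ 3 * ε ^ (-(3 / 4) : ℝ) := by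
  set D : ℝ := J * decayConst with hD
  have hD1 : 1 ≤ D := by
    have : (1 : ℝ) ≤ J := by exact_mod_cast hJ
    rw [hD, decayConst]; linarith
  have hsq : ∀ a, HasSum (fun n => ‖torusCoeff (fun k => (dyadicMajorant ε J a k : ℂ)) n‖ ^ 2)
      (∫ k, dyadicMajorant ε J a k ^ 2) := by
    intro a
    have hc := continuous_dyadicMajorant hε J a
    have := hasSum_norm_sq_torusCoeff (f := fun k => (dyadicMajorant ε J a k : ℂ)) (by fun_prop)
    simpa only [Complex.norm_real, Real.norm_eq_abs, sq_abs] using this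
  have hS : ∀ a, ∑' n, ‖torusCoeff (fun k => (dyadicMajorant ε J a k : ℂ)) n‖ ^ 2 ≤ 2 / ε * D :=
    fun a => (hsq a).tsum_eq.trans_le (integral_dyadicMajorant_sq_le hε J a)
  set X := ε ^ (-(1 / 4) : ℝ) with hX
  have hX0 : 0 < X := by positivity
  have hX1 : 1 ≤ X := Real.one_le_rpow_of_pos_of_le_one_of_nonpos hε hε1 (by norm_num)
  have hX3 : ε ^ (-(3 / 4) : ℝ) = X ^ 3 := by
    rw [hX, ← Real.rpow_natCast, ← Real.rpow_mul hε.le]; norm_num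
  have hX4 : 1 / ε = X ^ 4 := by
    rw [hX, ← Real.rpow_natCast, ← Real.rpow_mul hε.le]; norm_num [Real.rpow_neg_one]
  -- N is about ε^(-1/2), which balances N^(3/2) against N^(-1/2) / ε.
  set N := ⌊X ^ 2⌋₊ with hN
  have hN1 : X ^ 2 ≤ (N : ℝ) + 1 := (Nat.lt_floor_add_one _).le
  have hN2 : (N : ℝ) + 1 ≤ (2 * X) ^ 2 := by
    have := Nat.floor_le (sq_nonneg X)
    nlinarith
  have hlow : ((N : ℝ) + 1) ^ (1 / 2 : ℝ) ≤ 2 * X := by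
    rw [← Real.sqrt_eq_rpow]
    exact Real.sqrt_le_iff.2 ⟨by positivity, hN2⟩
  have hhigh : ((N : ℝ) + 1) ^ (-(1 / 2) : ℝ) ≤ X⁻¹ := by
    rw [Real.rpow_neg (by positivity), ← Real.sqrt_eq_rpow]
    exact inv_anti₀ hX0 (Real.le_sqrt_of_sq_le hN1)
  have hmain := (abs_integral_triple_le_tsum (continuous_dyadicMajorant hε J a)
    (continuous_dyadicMajorant hε J b) (continuous_dyadicMajorant hε J c) w).trans
    (tsum_triple_le (D := D) (S := 2 / ε * D) (by linarith) (fun n => norm_nonneg _)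
      (fun n => norm_nonneg _) (fun n => norm_nonneg _)
      (fun n j => by
        simpa using norm_torusCoeff_dyadicMajorant_le hε J a (-n) j)
      (fun n j => norm_torusCoeff_dyadicMajorant_le hε J b n j)
      (fun n j => norm_torusCoeff_dyadicMajorant_le hε J c n j)
      (hsq b).summable (hsq c).summable (hS b) (hS c) N)
  refine (le_abs_self _).trans (hmain.trans ?_)
  have h2e : 2 / ε = 2 * X ^ 4 := by rw [← hX4]; ring
  calc _ ≤ D ^ 3 * (4 * (2 * X)) ^ 3 + D * X⁻¹ * (2 / ε * D) := by gcongr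
    _ = 512 * D ^ 3 * X ^ 3 + 2 * D ^ 2 * X ^ 3 := by
        rw [h2e]
        field_simp
        ring
    _ ≤ 1000 * D ^ 3 * X ^ 3 := by
        have h1 : D ^ 2 ≤ D ^ 3 := pow_le_pow_right₀ hD1 (by norm_num)
        have h2 : D ^ 2 * X ^ 3 ≤ D ^ 3 * X ^ 3 := by gcongr
        have h3 : 0 ≤ D ^ 3 * X ^ 3 := by positivity
        nlinarith
    _ = _ := by rw [hX3]

/-- The sign is removed by q ↦ -q, as the majorant is even. -/
theorem integral_triple_signed_dyadicMajorant_le {ε : ℝ} (hε : 0 < ε) (hε1 : ε ≤ 1) {J : ℕ}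
    (hJ : 1 ≤ J) (a b c : ℝ) (κ : ℤˣ) (w : Torus3) :
    ∫ p, dyadicMajorant ε J a p *
        ∫ q, dyadicMajorant ε J b q * dyadicMajorant ε J c (p + (κ : ℤ) • q + w) ≤
      1000 * (J * decayConst) ^ 3 * ε ^ (-(3 / 4) : ℝ) := by
  refine le_trans (le_of_eq ?_) (integral_triple_dyadicMajorant_le hε hε1 hJ a b c w)
  congr 1
  funext p
  congr 1
  rcases Int.units_eq_one_or κ with rfl | rfl
  · simp
  · have : (volume : Measure Torus3).IsNegInvariant :=
      Measure.IsAddHaarMeasure.isNegInvariant_of_regular _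
    rw [← integral_neg_eq_self (fun q : Torus3 => dyadicMajorant ε J b q *
      dyadicMajorant ε J c (p + ((-1 : ℤˣ) : ℤ) • q + w)) volume]
    simp [dyadicMajorant_neg]

/-! ### Domination of the resolvents -/

/-- One scale suffices: if δ ≤ y < 2δ for y the square root, then δ² + x² ≤ 2y² ≤ 4 δ y. The
condition on J ensures that this scale occurs in the sum. -/
theorem inv_sqrt_le_dyadicMajorant {ε : ℝ} (hε : 0 < ε) {J : ℕ} (hJ : 8 < 2 ^ J * ε)
    {a : ℝ} {k : Torus3} (hy : √((kineticEnergy k - a) ^ 2 + ε ^ 2) ≤ 8) :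
    (√((kineticEnergy k - a) ^ 2 + ε ^ 2))⁻¹ ≤ 4 * dyadicMajorant ε J a k := by
  set x := kineticEnergy k - a with hx
  set y := √(x ^ 2 + ε ^ 2) with hyd
  have hy2 : y ^ 2 = x ^ 2 + ε ^ 2 := Real.sq_sqrt (by positivity)
  have hεy : ε ≤ y := Real.le_sqrt_of_sq_le (by nlinarith [sq_nonneg x])
  have hy0 : 0 < y := hε.trans_le hεy
  obtain ⟨l, hl1, hl2⟩ := exists_nat_pow_near ((one_le_div hε).2 hεy) (one_lt_two (α := ℝ))
  rw [le_div_iff₀ hε] at hl1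
  rw [div_lt_iff₀ hε, pow_succ] at hl2
  have hlJ : l < J := by
    by_contra h
    have : (2 : ℝ) ^ J ≤ 2 ^ l := pow_le_pow_right₀ one_le_two (not_lt.1 h)
    nlinarith
  have h1 : lorentzian (2 ^ l * ε) x ≤ dyadicMajorant ε J a k :=
    Finset.single_le_sum (f := fun l => lorentzian (2 ^ l * ε) (kineticEnergy k - a))
      (fun i _ => lorentzian_nonneg (by positivity) _) (Finset.mem_range.2 hlJ)
  refine le_trans ?_ (mul_le_mul_of_nonneg_left h1 (by norm_num))
  unfold lorentzian
  set δ := 2 ^ l * ε with hδ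
  have hδ0 : 0 < δ := by positivity
  rw [← mul_div_assoc, le_div_iff₀ (by positivity), ← div_eq_inv_mul, div_le_iff₀ hy0]
  have h2 : y < 2 * δ := by rw [hδ]; linarith
  have h3 : δ ^ 2 ≤ y ^ 2 := by gcongr
  nlinarith [sq_nonneg ε]

theorem spectralParameter_cases {z : ℂ} (hz : z ∈ contour ∨ z ∈ conjContour) :
    z.re ∈ Set.Icc (-1 : ℝ) 7 ∧ (z.im = 0 ∨ |z.im| = 1 ∨ z.re = -1 ∨ z.re = 7) := by
  have h : ∀ z ∈ contour,
      z.re ∈ Set.Icc (-1 : ℝ) 7 ∧ (z.im = 0 ∨ |z.im| = 1 ∨ z.re = -1 ∨ z.re = 7) := by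
    intro z hz
    simp only [contour, Set.mem_union, Complex.mem_reProdIm, Set.mem_singleton_iff] at hz
    rcases hz with h | (h | h) | h
    · exact ⟨h.1, Or.inl h.2⟩
    · exact ⟨h.1, Or.inr (Or.inl (by rw [h.2]; simp))⟩
    · exact ⟨by rw [h.1]; norm_num, Or.inr (Or.inr (Or.inl h.1))⟩
    · exact ⟨by rw [h.1]; norm_num, Or.inr (Or.inr (Or.inr h.1))⟩
  rcases hz with hz | ⟨z, hz, rfl⟩
  · exact h z hz
  · simpa using h z hz

/-- On the real side of the contour the two quantities agree. On the other sides the denominator is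
at least 1/2, because ε ≤ 1/2 or because z.re is at distance 1 from the energy range [0, 6]; hence
16 = 8 / (1/2). -/
theorem sqrt_le_mul_norm_resolvent {ε : ℝ} (hε : 0 < ε) (hε2 : ε ≤ 1 / 2) (s : ℤˣ) {z : ℂ}
    (hz : z ∈ contour ∨ z ∈ conjContour) (k : Torus3) :
    √((kineticEnergy k - z.re) ^ 2 + ε ^ 2) ≤ 8 ∧
    √((kineticEnergy k - z.re) ^ 2 + ε ^ 2) ≤
      16 * ‖(kineticEnergy k : ℂ) - z + ((s : ℤ) : ℂ) * Complex.I * (ε : ℂ)‖ := by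
  obtain ⟨⟨hre1, hre2⟩, hcases⟩ := spectralParameter_cases hz
  obtain ⟨he0, he6⟩ := kineticEnergy_mem_Icc k
  set v : ℂ := (kineticEnergy k : ℂ) - z + ((s : ℤ) : ℂ) * Complex.I * (ε : ℂ) with hv
  have hvre : v.re = kineticEnergy k - z.re := by simp [hv]
  have hvim : v.im = -z.im + (s : ℤ) * ε := by simp [hv]
  have h8 : √((kineticEnergy k - z.re) ^ 2 + ε ^ 2) ≤ 8 :=
    Real.sqrt_le_iff.2 ⟨by norm_num, by nlinarith⟩
  refine ⟨h8, ?_⟩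
  have hs : ((s : ℤ) : ℝ) = 1 ∨ ((s : ℤ) : ℝ) = -1 := by
    rcases Int.units_eq_one_or s with rfl | rfl <;> simp
  rcases hcases with h | h | h | h
  · have : √((kineticEnergy k - z.re) ^ 2 + ε ^ 2) = ‖v‖ := by
      rw [Complex.norm_eq_sqrt_sq_add_sq, hvre, hvim, h]
      rcases hs with h | h <;> rw [h] <;> ring_nf
    rw [this]
    linarith [norm_nonneg v]
  · have : 1 / 2 ≤ |v.im| := by
      rw [hvim]
      rcases eq_or_eq_neg_of_abs_eq h with h | h <;> rcases hs with h' | h' <;> rw [h, h'] <;>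
        rw [le_abs] <;> [right; right; left; left] <;> linarith
    linarith [Complex.abs_im_le_norm v]
  · have : 1 / 2 ≤ |v.re| := by
      rw [hvre, h, le_abs]; left; linarith
    linarith [Complex.abs_re_le_norm v]
  · have : 1 / 2 ≤ |v.re| := by
      rw [hvre, h, le_abs]; right; linarith
    linarith [Complex.abs_re_le_norm v]

theorem resolventModulus_le {ε : ℝ} (hε : 0 < ε) (hε2 : ε ≤ 1 / 2) {J : ℕ} (hJ : 8 < 2 ^ J * ε)
    (s : ℤˣ) {z : ℂ} (hz : z ∈ contour ∨ z ∈ conjContour) (k : Torus3) :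
    resolventModulus ε s z k ≤ ENNReal.ofReal (64 * dyadicMajorant ε J z.re k) := by
  obtain ⟨h8, hv⟩ := sqrt_le_mul_norm_resolvent hε hε2 s hz k
  unfold resolventModulus
  set v : ℂ := (kineticEnergy k : ℂ) - z + ((s : ℤ) : ℂ) * Complex.I * (ε : ℂ)
  set y := √((kineticEnergy k - z.re) ^ 2 + ε ^ 2) with hy
  have hy0 : 0 < y := Real.sqrt_pos.2 (by positivity)
  have hv0 : 0 < ‖v‖ := by linarith
  have h1 := inv_sqrt_le_dyadicMajorant hε hJ h8
  rw [← ofReal_norm, ← ENNReal.ofReal_inv_of_pos hv0]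
  refine ENNReal.ofReal_le_ofReal ?_
  have h2 : ‖v‖⁻¹ ≤ 16 * y⁻¹ := by
    rw [inv_le_iff_one_le_mul₀ hv0, mul_right_comm, ← div_eq_mul_inv, one_le_div hy0]
    exact hv
  linarith

/-! ### The crossing estimate -/

theorem crossingIntegral_le {ε : ℝ} (hε : 0 < ε) (hε2 : ε ≤ 1 / 2) {J : ℕ} (hJ1 : 1 ≤ J)
    (hJ : 8 < 2 ^ J * ε) (s : Fin 3 → ℤˣ) (κ : ℤˣ) (ν : Fin 3 → Fin 2) (w : Torus3) {α β : ℂ}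
    (hα : α ∈ contour) (hβ : β ∈ conjContour) :
    crossingIntegral s κ ν ε w α β ≤ ENNReal.ofReal
      (64 ^ 3 * (1000 * (J * decayConst) ^ 3 * ε ^ (-(3 / 4) : ℝ))) := by
  have hz : ∀ i : Fin 2, ![α, β] i ∈ contour ∨ ![α, β] i ∈ conjContour := by
    intro i
    fin_cases i
    · exact Or.inl hα
    · exact Or.inr hβ
  set G : Fin 3 → Torus3 → ℝ := fun i => dyadicMajorant ε J (![α, β] (ν i)).re with hG
  have hG0 : ∀ i k, 0 ≤ G i k := fun i k => dyadicMajorant_nonneg hε J _ k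
  have hGc : ∀ i, Continuous (G i) := fun i => continuous_dyadicMajorant hε J _
  set F : Torus3 × Torus3 → ℝ := fun x =>
    64 ^ 3 * (G 0 x.1 * (G 1 x.2 * G 2 (x.1 + (κ : ℤ) • x.2 + w))) with hF
  have hFc : Continuous F := by
    have h0 := hGc 0
    have h1 := hGc 1
    have h2 := hGc 2
    fun_prop
  have hFi : Integrable F (volume.prod volume) :=
    hFc.integrable_of_hasCompactSupport (.of_compactSpace _)
  have hF0 : ∀ x, 0 ≤ F x := fun x => mul_nonneg (by norm_num)
    (mul_nonneg (hG0 0 _) (mul_nonneg (hG0 1 _) (hG0 2 _)))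
  have hle : crossingIntegral s κ ν ε w α β ≤ ∫⁻ x, ENNReal.ofReal (F x) ∂volume.prod volume := by
    refine lintegral_mono fun x => ?_
    refine (mul_le_mul' (mul_le_mul' (resolventModulus_le hε hε2 hJ _ (hz _) _)
      (resolventModulus_le hε hε2 hJ _ (hz _) _))
      (resolventModulus_le hε hε2 hJ _ (hz _) _)).trans_eq ?_
    rw [← ENNReal.ofReal_mul (mul_nonneg (by norm_num) (hG0 0 _)), ← ENNReal.ofReal_mul
      (mul_nonneg (mul_nonneg (by norm_num) (hG0 0 _)) (mul_nonneg (by norm_num) (hG0 1 _)))]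
    congr 1
    simp only [hF, hG]
    ring
  refine hle.trans ?_
  rw [← ofReal_integral_eq_lintegral_ofReal hFi (.of_forall hF0)]
  refine ENNReal.ofReal_le_ofReal ?_
  rw [integral_prod _ hFi]
  simp only [hF, integral_const_mul]
  gcongr
  exact integral_triple_signed_dyadicMajorant_le hε (by linarith) hJ1 _ _ _ κ w

/-- J is logarithmic in 1 / ε. The exponent 1/60 is chosen so that J³ costs ε^(-1/20), exactly 4/5 -
3/4; 961 = 120 · 8 + 1. -/
theorem exists_dyadic_scale {ε : ℝ} (hε : 0 < ε) (hε2 : ε ≤ 1 / 2) :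
    ∃ J : ℕ, 1 ≤ J ∧ 8 < 2 ^ J * ε ∧ (J : ℝ) ≤ 961 * ε ^ (-(1 / 60) : ℝ) := by
  obtain ⟨n, hn1, hn2⟩ := exists_nat_pow_near (x := 8 / ε)
    (by rw [one_le_div hε]; linarith) (one_lt_two (α := ℝ))
  rw [div_lt_iff₀ hε] at hn2
  refine ⟨n + 1, by omega, hn2, ?_⟩
  have hX1 : 1 ≤ ε ^ (-(1 / 60) : ℝ) :=
    Real.one_le_rpow_of_pos_of_le_one_of_nonpos hε (by linarith) (by norm_num)
  have h1 : (n : ℝ) / 120 ≤ ((2 : ℝ) ^ n) ^ (1 / 60 : ℝ) := by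
    rw [← Real.rpow_natCast, ← Real.rpow_mul (by norm_num), Real.rpow_def_of_pos (by norm_num)]
    have h0 : (0 : ℝ) ≤ n := Nat.cast_nonneg n
    nlinarith [Real.add_one_le_exp (Real.log 2 * (n * (1 / 60))), Real.log_two_gt_d9]
  have h2 : ((2 : ℝ) ^ n) ^ (1 / 60 : ℝ) ≤ 8 * ε ^ (-(1 / 60) : ℝ) := by
    refine (Real.rpow_le_rpow (by positivity) hn1 (by norm_num)).trans ?_
    rw [Real.div_rpow (by norm_num) hε.le, Real.rpow_neg hε.le, div_eq_mul_inv]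
    gcongr
    exact Real.rpow_le_self_of_one_le (by norm_num) (by norm_num)
  push_cast
  linarith

end LatticeCrossing

theorem lemma7p8 :
    ∃ C : ℝ, 0 < C ∧ ∀ ε : ℝ, 0 < ε → ε ≤ 1 / 2 →
      ∀ (s : Fin 3 → ℤˣ) (κ : ℤˣ) (ν : Fin 3 → Fin 2),
        (⨆ w : LatticeCrossing.Torus3,
          ⨆ α ∈ LatticeCrossing.contour,
            ⨆ β ∈ LatticeCrossing.conjContour,
              LatticeCrossing.crossingIntegral s κ ν ε w α β)
          < ENNReal.ofReal (C * ε ^ (-(4 / 5) : ℝ) * (Real.log (1 / ε)) ^ 2) := by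
  set K : ℝ := 64 ^ 3 * (1000 * (961 * LatticeCrossing.decayConst) ^ 3) with hK
  have hd : 0 < LatticeCrossing.decayConst := by unfold LatticeCrossing.decayConst; norm_num
  have hK0 : 0 < K := by positivity
  refine ⟨5 * K, by positivity, fun ε hε hε2 s κ ν => ?_⟩
  obtain ⟨J, hJ1, hJ, hJε⟩ := LatticeCrossing.exists_dyadic_scale hε hε2
  have hbound : 64 ^ 3 * (1000 * (J * LatticeCrossing.decayConst) ^ 3 * ε ^ (-(3 / 4) : ℝ)) ≤
      K * ε ^ (-(4 / 5) : ℝ) := by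
    have h1 : ε ^ (-(4 / 5) : ℝ) = (ε ^ (-(1 / 60) : ℝ)) ^ 3 * ε ^ (-(3 / 4) : ℝ) := by
      rw [← Real.rpow_natCast, ← Real.rpow_mul hε.le, ← Real.rpow_add hε]
      norm_num
    calc _ ≤ 64 ^ 3 * (1000 * (961 * ε ^ (-(1 / 60) : ℝ) * LatticeCrossing.decayConst) ^ 3 *
          ε ^ (-(3 / 4) : ℝ)) := by gcongr
      _ = _ := by rw [h1, hK]; ring
  -- The logarithms are already absorbed in the power, so a lower bound on log² suffices; the factor
  -- 5 > 4 in the constant makes the inequality strict.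
  have hlog : 1 / 4 < Real.log (1 / ε) ^ 2 := by
    have h2 : Real.log 2 ≤ Real.log (1 / ε) :=
      Real.log_le_log two_pos ((le_div_iff₀ hε).2 (by linarith))
    nlinarith [Real.log_two_gt_d9]
  have hlt : K * ε ^ (-(4 / 5) : ℝ) < 5 * K * ε ^ (-(4 / 5) : ℝ) * Real.log (1 / ε) ^ 2 := by
    have : 0 < K * ε ^ (-(4 / 5) : ℝ) := by positivity
    nlinarith
  refine lt_of_le_of_lt (b := ENNReal.ofReal (K * ε ^ (-(4 / 5) : ℝ))) ?_
    ((ENNReal.ofReal_lt_ofReal_iff (lt_trans (by positivity) hlt)).2 hlt)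
  refine iSup_le fun w => iSup₂_le fun α hα => iSup₂_le fun β hβ => ?_
  exact (LatticeCrossing.crossingIntegral_le hε hε2 hJ1 hJ s κ ν w hα hβ).trans
    (ENNReal.ofReal_le_ofReal hbound)
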